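/- Let $k$ be a field and let $G$, $G'$ be finite groups with $\operatorname{char} k\nmid |G|$ and $\operatorname{char} k\nmid |G'|$. Write $\mathcal K(G)$ for the set of conjugacy classes of $G$ and $Z_s$ for the centralizer of $s\in G$. *RSR's.* A ramification system with irreducible representations (RSR) $(G,r,\overrightarrow\rho,u)$ consists of a ramification $r=\sum_C r_C C$ (a cardinal number $r_C$ for each $C\in\mathcal K(G)$), elements $u(C)\in C$ for $C\in\mathcal K(G)$, index sets $I_C(r,u)$ and, for $i\in I_C(r,u)$, an irreducible right $k$-representation $\rho_C^{(i)}$ of $Z_{u(C)}$ on a space $X_C^{(i)}$ and a set $J_C(i)$ with $|J_C(i)|=\deg\rho_C^{(i)}$, such that the set $I_C(r)=\{(i,j)\mid i\in I_C(r,u),\,j\in J_C(i)\}$ has cardinality $r_C$ (so $I_C(r,u)=\emptyset$ if $r_C=0$). Two RSR's $(G,r,\overrightarrow\rho,u)$ and $(G',r',\overrightarrow{\rho'},u')$ are isomorphic if there are a group isomorphism $\phi:G\to G'$ and, for every $C\in\mathcal K(G)$, an element $h_C\in G$ with $\phi(h_C^{-1}u(C)h_C)=u'(\phi(C))$ and a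 bijection $\phi_C:I_C(r,u)\to I_{\phi(C)}(r',u')$ with $\rho_C^{(i)}\cong\rho'^{(\phi_C(i))}_{\phi(C)}\circ\phi_{h_C}$ as representations of $Z_{u(C)}$ for all $i$, where $\phi_{h}(x)=\phi(h^{-1}xh)$. *The module $(kQ_1^{1a},\mathrm{coad}(G,r,\overrightarrow\rho,u))$.* The Hopf quiver $Q$ has vertex set $G$ and arrows $a_{y,x}^{(i,j)}$ from $x$ to $y$ with $(i,j)\in I_C(r)$, $x^{-1}y\in C$. Choose bases $\{x_C^{(i,j)}\}_{j\in J_C(i)}$ of the $X_C^{(i)}$ and representatives $g_\theta$ of the cosets $Z_{u(C)}g_\theta$ in $G$, with $Z_{u(C)}$ represented by $1$. Let $g_\theta h=\zeta_\theta(h)g_{\theta'}$ with $\zeta_\theta(h)\in Z_{u(C)}$. The group algebra $kG$ acts on the space $kQ_1$ spanned by the arrows by $h\cdot a_{y,x}^{(i,j)}=a_{hy,hx}^{(i,j)}$ and $a_{y,x}^{(i,j)}\cdot h=\sum_s c_s\,a_{yh,xh}^{(i,s)}$, where $x^{-1}y=g_\theta^{-1}u(C)g_\theta$ and $x_C^{(i,j)}\cdot\zeta_\theta(h)=\sum_s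 c_s x_C^{(i,s)}$. If $Q$ is finite, then $kQ_1^a$ is the dual space of $kQ_1$, again identified with the span of the arrows through the dual basis, with the left and right $(kG)^*$-coactions dual to these actions and with the left $(kG)^*$-action $p_g\cdot a=\delta_{g,t(a)}a$, where $t(a)$ is the end vertex of $a$ and $(p_g)_{g\in G}$ is the basis of $(kG)^*$ dual to $G$. With this left action and the adjoint coaction $\delta^-_{\mathrm{coad}}(x)=\sum x_{(-1)}S(x_{(0)(1)})\otimes x_{(0)(0)}$ it is a left-left Yetter–Drinfeld $(kG)^*$-module; $(kQ_1^{1a},\mathrm{coad}(G,r,\overrightarrow\rho,u))$ is its Yetter–Drinfeld submodule spanned by the arrows that start at $1$. *Nichols algebras.* For a left-left Yetter–Drinfeld module $V$ over a Hopf algebra $H$, the Nichols algebra $\mathcal B(V)$ is the quotient of the tensor algebra $T(V)$, with its structure of graded braided Hopf algebra in ${}^H_H\mathcal{YD}$ for which the elements of $V$ are primitive, by the largest two-sided homogeneous ideal contained in $\bigoplus_{n\ge2}V^{\otimes n}$ that is a coideal and a Yetter–Drinfeld submodule. For a Hopf algebra isomorphism $\phi:H\to H'$ and an object $M$ over $H'$,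 ${}_\phi^{\phi^{-1}}M$ denotes $M$ with its action pulled back along $\phi$ and its coaction pushed out along $\phi^{-1}$. **Proposition.** Let $(G,r,\overrightarrow\rho,u)$ and $(G',r',\overrightarrow{\rho'},u')$ be two RSR's whose Hopf quivers $Q$ and $Q'$ are finite. For all choices of bases and coset representatives as above, the following statements are equivalent: (i) $(G,r,\overrightarrow\rho,u)$ and $(G',r',\overrightarrow{\rho'},u')$ are isomorphic as RSR's. (ii) There is a Hopf algebra isomorphism $\phi:(kG)^*\to(kG')^*$ such that $(kQ_1^{1a},\mathrm{coad}(G,r,\overrightarrow\rho,u))\cong{}_\phi^{\phi^{-1}}(kQ_1'^{1a},\mathrm{coad}(G',r',\overrightarrow{\rho'},u'))$ as Yetter–Drinfeld $(kG)^*$-modules. (iii) There is a Hopf algebra isomorphism $\phi:(kG)^*\to(kG')^*$ such that $\mathcal B(kQ_1^{1a},\mathrm{coad}(G,r,\overrightarrow\rho,u))\cong{}_\phi^{\phi^{-1}}\mathcal B(kQ_1'^{1a},\mathrm{coad}(G',r',\overrightarrow{\rho'},u'))$ as graded braided Hopf algebras in ${}^{(kG)^*}_{(kG)^*}\mathcal{YD}$.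 -/

import Mathlib

open scoped TensorProduct

set_option linter.unusedSectionVars false

namespace QuiverHopf

noncomputable section

/-! ### The Hopf algebra `(kG)^*` -/

/-- The Hopf algebra `(kG)^*` dual to the group algebra of a finite group `G`. A linear form on
`kG` is recorded by its values on the basis `G`; see `DualGroupAlg.toDual`. -/
def DualGroupAlg (k G : Type*) : Type _ := G → k

namespace DualGroupAlg

variable {k G : Type*} [Field k]

instance : CommRing (DualGroupAlg k G) := inferInstanceAs (CommRing (G → k))
instance : Algebra k (DualGroupAlg k G) := inferInstanceAs (Algebra k (G → k))

instance : CoeFun (DualGroupAlg k G) (fun _ => G → k) := ⟨fun f => f⟩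

@[ext] theorem ext {f f' : DualGroupAlg k G} (h : ∀ g, f g = f' g) : f = f' := funext h

@[simp] theorem add_apply (f f' : DualGroupAlg k G) (g : G) : (f + f') g = f g + f' g := rfl
@[simp] theorem mul_apply (f f' : DualGroupAlg k G) (g : G) : (f * f') g = f g * f' g := rfl
@[simp] theorem one_apply (g : G) : (1 : DualGroupAlg k G) g = 1 := rfl
@[simp] theorem zero_apply (g : G) : (0 : DualGroupAlg k G) g = 0 := rfl
@[simp] theorem smul_apply (c : k) (f : DualGroupAlg k G) (g : G) : (c • f) g = c * f g := rfl
@[simp] theorem algebraMap_apply (c : k) (g : G) :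
    (algebraMap k (DualGroupAlg k G) c) g = c := rfl

/-- Evaluation at `g`, as an algebra map. -/
def eval (g : G) : DualGroupAlg k G →ₐ[k] k := Pi.evalAlgHom k (fun _ : G => k) g

@[simp] theorem eval_apply (g : G) (f : DualGroupAlg k G) : eval g f = f g := rfl

open Classical in
/-- The basis vector `p_g` of `(kG)^*` dual to `g ∈ G`. -/
def p (g : G) : DualGroupAlg k G := fun h => if h = g then 1 else 0

open Classical in
@[simp] theorem p_apply (g h : G) : (p g : DualGroupAlg k G) h = if h = g then 1 else 0 := rfl

open Classical in
@[simp] theorem sum_ite_p [Fintype G] {V : Type*} [AddCommMonoid V] (g : G) (F : G → V) :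
    ∑ x, (if g = x then F x else 0) = F g := by
  rw [Finset.sum_eq_single g (fun b _ hb => if_neg (Ne.symm hb))
    (fun h => absurd (Finset.mem_univ g) h), if_pos rfl]

@[simp] theorem sum_apply {ι : Type*} (s : Finset ι) (f : ι → DualGroupAlg k G) (g : G) :
    (∑ i ∈ s, f i) g = ∑ i ∈ s, f i g := Finset.sum_apply g s f

variable [Fintype G]

theorem sum_p (f : DualGroupAlg k G) : ∑ g, f g • (p g : DualGroupAlg k G) = f := by
  ext h
  simp only [sum_apply, smul_apply, p_apply, mul_ite, mul_one, mul_zero]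
  exact sum_ite_p h f

section Ext

variable {V : Type*} [AddCommGroup V] [Module k V]

/-- Evaluation at `g` of the first tensor factor. -/
def evalL (g : G) : DualGroupAlg k G ⊗[k] V →ₗ[k] V :=
  (TensorProduct.lid k V).toLinearMap ∘ₗ (eval g).toLinearMap.rTensor V

@[simp] theorem evalL_tmul (g : G) (f : DualGroupAlg k G) (v : V) :
    evalL g (f ⊗ₜ[k] v) = f g • v := by
  simp [evalL]

theorem sum_p_evalL (t : DualGroupAlg k G ⊗[k] V) :
    ∑ g, (p g : DualGroupAlg k G) ⊗ₜ[k] evalL g t = t := by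
  induction t with
  | zero => simp
  | tmul f v =>
    conv_rhs => rw [← sum_p f, TensorProduct.sum_tmul]
    simp [TensorProduct.smul_tmul]
  | add x y hx hy =>
    simp only [map_add, TensorProduct.tmul_add, Finset.sum_add_distrib, hx, hy]

theorem ext_evalL {t t' : DualGroupAlg k G ⊗[k] V} (h : ∀ g, evalL g t = evalL g t') : t = t' := by
  rw [← sum_p_evalL t, ← sum_p_evalL t']
  simp [h]

end Ext

variable [Group G]

/-- Left translate: `(shift g f) h = f (g * h)`. -/
def shift (g : G) : DualGroupAlg k G →ₗ[k] DualGroupAlg k G where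
  toFun f := fun h => f (g * h)
  map_add' _ _ := rfl
  map_smul' _ _ := rfl

@[simp] theorem shift_apply (g : G) (f : DualGroupAlg k G) (h : G) : shift g f h = f (g * h) := rfl

/-- The comultiplication is dual to the product of `kG`:
`Δ f = ∑_{g,h} f (g h) p_g ⊗ p_h`. -/
def comulMap : DualGroupAlg k G →ₗ[k] DualGroupAlg k G ⊗[k] DualGroupAlg k G :=
  ∑ g, (TensorProduct.mk k _ _ (p g)) ∘ₗ shift g

theorem evalL_comulMap (g : G) (f : DualGroupAlg k G) : evalL g (comulMap f) = shift g f := by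
  simp [comulMap]

instance : Coalgebra k (DualGroupAlg k G) where
  comul := comulMap
  counit := (eval (1 : G)).toLinearMap
  coassoc := by
    refine LinearMap.ext fun f => ext_evalL fun a => ext_evalL fun b => ?_
    have h1 : ∀ t : DualGroupAlg k G ⊗[k] DualGroupAlg k G,
        evalL b (evalL a (TensorProduct.assoc k _ _ _ (comulMap.rTensor (DualGroupAlg k G) t)))
          = evalL (a * b) t := by
      intro t
      induction t with
      | zero => simp
      | add x y hx hy => simp only [map_add, hx, hy]
      | tmul x y =>
        simp only [comulMap, LinearMap.rTensor_tmul, LinearMap.sum_apply, LinearMap.comp_apply,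
          TensorProduct.mk_apply, TensorProduct.sum_tmul, map_sum, TensorProduct.assoc_tmul,
          evalL_tmul, p_apply, ite_smul, one_smul, zero_smul, sum_ite_p, shift_apply]
    have h2 : ∀ t : DualGroupAlg k G ⊗[k] DualGroupAlg k G,
        evalL a (comulMap.lTensor (DualGroupAlg k G) t) = comulMap (evalL a t) := by
      intro t
      induction t with
      | zero => simp
      | add x y hx hy => simp only [map_add, hx, hy]
      | tmul x y => simp
    simp only [LinearMap.comp_apply, LinearEquiv.coe_coe]
    rw [h1, h2]
    simp only [evalL_comulMap]
    ext c
    simp [mul_assoc]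
  rTensor_counit_comp_comul := by
    refine LinearMap.ext fun f => (TensorProduct.lid k _).injective ?_
    have := evalL_comulMap (1 : G) f
    simp only [evalL, LinearMap.comp_apply, LinearEquiv.coe_coe] at this
    simp only [LinearMap.comp_apply, this]
    ext h
    simp
  lTensor_counit_comp_comul := by
    refine LinearMap.ext fun f => ext_evalL fun a => ?_
    have h2 : ∀ t : DualGroupAlg k G ⊗[k] DualGroupAlg k G,
        evalL a ((eval (1 : G)).toLinearMap.lTensor (DualGroupAlg k G) t) = (evalL a t) 1 := by
      intro t
      induction t with
      | zero => simp
      | add x y hx hy => simp only [map_add, hx, hy, add_apply]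
      | tmul x y => simp
    simp only [LinearMap.comp_apply]
    rw [h2, evalL_comulMap]
    simp

theorem comul_eq (f : DualGroupAlg k G) :
    Coalgebra.comul (R := k) f = ∑ g : G, (p g : DualGroupAlg k G) ⊗ₜ[k] shift g f := by
  change comulMap f = _
  simp [comulMap]

theorem evalL_comul (g : G) (f : DualGroupAlg k G) :
    evalL g (Coalgebra.comul (R := k) f) = shift g f := evalL_comulMap g f

@[simp] theorem counit_eq (f : DualGroupAlg k G) : Coalgebra.counit (R := k) f = f 1 := rfl

theorem evalL_mul (g : G) (t t' : DualGroupAlg k G ⊗[k] DualGroupAlg k G) :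
    evalL g (t * t') = evalL g t * evalL g t' := by
  induction t with
  | zero => simp
  | add x y hx hy => simp only [add_mul, map_add, hx, hy]
  | tmul x y =>
    induction t' with
    | zero => simp
    | add x y hx hy => simp only [mul_add, map_add, hx, hy]
    | tmul x' y' =>
      ext h
      simp only [Algebra.TensorProduct.tmul_mul_tmul, evalL_tmul, mul_apply, smul_apply]
      ring

instance : Bialgebra k (DualGroupAlg k G) :=
  Bialgebra.mk' k (DualGroupAlg k G) rfl (fun {_ _} => rfl)
    (by
      refine ext_evalL fun g => ?_
      rw [evalL_comul, Algebra.TensorProduct.one_def, evalL_tmul]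
      ext h
      simp)
    (fun {a b} => by
      refine ext_evalL fun g => ?_
      rw [evalL_mul]
      simp only [evalL_comul]
      ext h
      simp)

/-- The antipode `(S f) g = f g⁻¹`, dual to the antipode `g ↦ g⁻¹` of `kG`. -/
def antipodeMap : DualGroupAlg k G →ₗ[k] DualGroupAlg k G where
  toFun f := fun g => f g⁻¹
  map_add' _ _ := rfl
  map_smul' _ _ := rfl

@[simp] theorem antipodeMap_apply (f : DualGroupAlg k G) (g : G) : antipodeMap f g = f g⁻¹ := rfl

theorem mul'_apply (t : DualGroupAlg k G ⊗[k] DualGroupAlg k G) (g : G) :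
    LinearMap.mul' k _ t g = evalL g t g := by
  induction t with
  | zero => simp
  | add x y hx hy => simp only [map_add, hx, hy, add_apply]
  | tmul x y => simp

instance : HopfAlgebra k (DualGroupAlg k G) where
  antipode := antipodeMap
  mul_antipode_rTensor_comul := by
    refine LinearMap.ext fun f => ext fun g => ?_
    have h2 : ∀ t : DualGroupAlg k G ⊗[k] DualGroupAlg k G,
        evalL g (antipodeMap.rTensor (DualGroupAlg k G) t) = evalL g⁻¹ t := by
      intro t
      induction t with
      | zero => simp
      | add x y hx hy => simp only [map_add, hx, hy]
      | tmul x y => simp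
    simp only [LinearMap.comp_apply, mul'_apply, h2, evalL_comul]
    simp
  mul_antipode_lTensor_comul := by
    refine LinearMap.ext fun f => ext fun g => ?_
    have h2 : ∀ t : DualGroupAlg k G ⊗[k] DualGroupAlg k G,
        evalL g (antipodeMap.lTensor (DualGroupAlg k G) t) = antipodeMap (evalL g t) := by
      intro t
      induction t with
      | zero => simp
      | add x y hx hy => simp only [map_add, hx, hy]
      | tmul x y => simp
    simp only [LinearMap.comp_apply, mul'_apply, h2, evalL_comul]
    simp

@[simp] theorem antipode_apply (f : DualGroupAlg k G) (g : G) :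
    HopfAlgebra.antipode k f g = f g⁻¹ := rfl

/-- The identification of `G → k` with the linear dual of the group algebra `kG`. -/
def toDual : DualGroupAlg k G ≃ₗ[k] Module.Dual k (MonoidAlgebra k G) :=
  (MonoidAlgebra.basis G k).constr k

theorem toDual_single (f : DualGroupAlg k G) (g : G) :
    toDual f (MonoidAlgebra.single g 1) = f g :=
  (MonoidAlgebra.basis G k).constr_basis k f g

/-- The product of `(kG)^*` is dual to the coproduct of `kG`. -/
theorem toDual_mul (f f' : DualGroupAlg k G) (x : MonoidAlgebra k G) :
    toDual (f * f') x =
      LinearMap.mul' k k (TensorProduct.map (toDual f) (toDual f') (Coalgebra.comul (R := k) x)) := by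
  have : toDual (f * f') = LinearMap.mul' k k ∘ₗ TensorProduct.map (toDual f) (toDual f') ∘ₗ
      Coalgebra.comul (R := k) (A := MonoidAlgebra k G) := by
    refine (MonoidAlgebra.basis G k).ext fun g => ?_
    change toDual (f * f') (MonoidAlgebra.single g 1) = LinearMap.mul' k k
      (TensorProduct.map (toDual f) (toDual f') (Coalgebra.comul (MonoidAlgebra.single g 1)))
    simp [toDual_single]
  exact LinearMap.congr_fun this x

/-- The coproduct of `(kG)^*` is dual to the product of `kG`. -/
theorem toDual_comul (f : DualGroupAlg k G) (x y : MonoidAlgebra k G) :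
    toDual f (x * y) = TensorProduct.dualDistrib k _ _
      (TensorProduct.map toDual.toLinearMap toDual.toLinearMap (Coalgebra.comul (R := k) f))
      (x ⊗ₜ[k] y) := by
  have key : ∀ g h : G, toDual f (MonoidAlgebra.single g 1 * MonoidAlgebra.single h 1) =
      TensorProduct.dualDistrib k _ _
        (TensorProduct.map toDual.toLinearMap toDual.toLinearMap (Coalgebra.comul (R := k) f))
        (MonoidAlgebra.single g 1 ⊗ₜ[k] MonoidAlgebra.single h 1) := by
    intro g h
    rw [comul_eq, MonoidAlgebra.single_mul_single, mul_one, toDual_single]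
    simp only [map_sum, LinearMap.sum_apply, TensorProduct.map_tmul, LinearEquiv.coe_coe,
      TensorProduct.dualDistrib_apply, toDual_single, p_apply, ite_mul, one_mul, zero_mul,
      sum_ite_p, shift_apply]
  induction x using MonoidAlgebra.induction_linear with
  | zero => simp
  | add x x' hx hx' => simp only [add_mul, map_add, TensorProduct.add_tmul, hx, hx']
  | single g a =>
    induction y using MonoidAlgebra.induction_linear with
    | zero => simp
    | add y y' hy hy' => simp only [mul_add, map_add, TensorProduct.tmul_add, hy, hy']
    | single h b =>
      have h1 : (MonoidAlgebra.single g a : MonoidAlgebra k G) =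
        a • MonoidAlgebra.single g 1 := by simp
      have h2 : (MonoidAlgebra.single h b : MonoidAlgebra k G) =
        b • MonoidAlgebra.single h 1 := by simp
      rw [h1, h2, smul_mul_smul_comm, TensorProduct.smul_tmul_smul, map_smul, map_smul, key]

end DualGroupAlg

/-! ### Yetter–Drinfeld modules -/

/-- A left-left Yetter–Drinfeld structure over the Hopf algebra `H` on the vector space `V`. -/
structure YetterDrinfeld (k H V : Type*) [Field k] [Ring H] [HopfAlgebra k H]
    [AddCommGroup V] [Module k V] where
  /-- the left action -/
  act : H →ₐ[k] Module.End k V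
  /-- the left coaction -/
  coact : V →ₗ[k] H ⊗[k] V
  /-- `(Δ ⊗ id) δ = (id ⊗ δ) δ` -/
  coassoc : (TensorProduct.assoc k H H V).toLinearMap ∘ₗ
      (Coalgebra.comul (R := k) (A := H)).rTensor V ∘ₗ coact = coact.lTensor H ∘ₗ coact
  /-- `(ε ⊗ id) δ = id` -/
  counit_coact : (TensorProduct.lid k V).toLinearMap ∘ₗ
      (Coalgebra.counit (R := k) (A := H)).rTensor V ∘ₗ coact = LinearMap.id
  /-- `h₁ v₍₋₁₎ ⊗ h₂ v₍₀₎ = (h₁ v)₍₋₁₎ h₂ ⊗ (h₁ v)₍₀₎` -/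
  compat :
    TensorProduct.map (LinearMap.mul' k H) (TensorProduct.lift act.toLinearMap) ∘ₗ
        (TensorProduct.tensorTensorTensorComm k H H H V).toLinearMap ∘ₗ
        TensorProduct.map (Coalgebra.comul (R := k) (A := H)) coact =
      (LinearMap.mul' k H).rTensor V ∘ₗ (TensorProduct.rightComm k H V H).toLinearMap ∘ₗ
        (coact ∘ₗ TensorProduct.lift act.toLinearMap).rTensor H ∘ₗ
        (TensorProduct.rightComm k H H V).toLinearMap ∘ₗ
        (Coalgebra.comul (R := k) (A := H)).rTensor V

namespace YetterDrinfeld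

variable {k H V : Type*} [Field k] [Ring H] [HopfAlgebra k H] [AddCommGroup V] [Module k V]
variable {H' V' : Type*} [Ring H'] [HopfAlgebra k H'] [AddCommGroup V'] [Module k V']

/-- A pull-push isomorphism `(φ, ψ)` of Yetter–Drinfeld modules: `ψ` is a bijective left
`H`-module map from `V` to the pullback of `V'` along `φ` and a left `H'`-comodule map from the
pushout of `V` along `φ` to `V'`. For bijective `φ` this says that `ψ` is an isomorphism of
Yetter–Drinfeld `H`-modules from `V` to `V'` with action pulled back along `φ` and coaction
pushed out along `φ⁻¹`. -/
structure PullPushIso (Y : YetterDrinfeld k H V) (Y' : YetterDrinfeld k H' V')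
    (φ : H ≃ₐc[k] H') where
  /-- the underlying linear isomorphism `ψ` -/
  ψ : V ≃ₗ[k] V'
  map_act : ∀ (h : H) (v : V), ψ (Y.act h v) = Y'.act (φ h) (ψ v)
  map_coact : ∀ v : V, TensorProduct.map (φ : H →ₗ[k] H') ψ.toLinearMap (Y.coact v) =
    Y'.coact (ψ v)

/-! ### The Nichols algebra

`T(V)` is the tensor algebra with its structure of graded braided Hopf algebra in the category of
Yetter–Drinfeld `H`-modules; the Nichols algebra is its quotient by the largest homogeneous
Hopf ideal which is a Yetter–Drinfeld submodule and is contained in degrees `≥ 2`. -/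

variable (Y : YetterDrinfeld k H V)

/-- The action of `H` on `T(V)` determined by `h • (x y) = (h₁ • x) (h₂ • y)`, `h • 1 = ε(h)`
and the action on `V`: the map `x ↦ (h ↦ h • x)` is an algebra map to the convolution algebra. -/
def tensorActAux : TensorAlgebra k V →ₐ[k] WithConv (H →ₗ[k] TensorAlgebra k V) :=
  TensorAlgebra.lift k
    ((WithConv.linearEquiv k (H →ₗ[k] TensorAlgebra k V)).symm.toLinearMap ∘ₗ
      (Y.act.toLinearMap.flip.compr₂ (TensorAlgebra.ι k)))

/-- The action `H → End T(V)`. -/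
def tensorAct : H →ₗ[k] TensorAlgebra k V →ₗ[k] TensorAlgebra k V :=
  LinearMap.flip
    ((WithConv.linearEquiv k (H →ₗ[k] TensorAlgebra k V)).toLinearMap ∘ₗ
      Y.tensorActAux.toLinearMap)

/-- The coaction of `H` on `T(V)`: the algebra map extending the coaction on `V`. -/
def tensorCoact : TensorAlgebra k V →ₐ[k] H ⊗[k] TensorAlgebra k V :=
  TensorAlgebra.lift k ((TensorAlgebra.ι k).lTensor H ∘ₗ Y.coact)

/-- For `v ∈ V`, left multiplication by `v ⊗ 1 + 1 ⊗ v` in the braided tensor product algebra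
`T(V) ⊗ T(V)`, whose product is `(a ⊗ b) (c ⊗ d) = a (b₍₋₁₎ • c) ⊗ b₍₀₎ d`; that is,
`c ⊗ d ↦ v c ⊗ d + (v₍₋₁₎ • c) ⊗ v₍₀₎ d`. -/
def primMul : V →ₗ[k] Module.End k (TensorAlgebra k V ⊗[k] TensorAlgebra k V) :=
  (LinearMap.rTensorHom (TensorAlgebra k V)) ∘ₗ
      LinearMap.mul k (TensorAlgebra k V) ∘ₗ TensorAlgebra.ι k +
    TensorProduct.homTensorHomMap (RingHom.id k) (TensorAlgebra k V) (TensorAlgebra k V)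
        (TensorAlgebra k V) (TensorAlgebra k V) ∘ₗ
      TensorProduct.map Y.tensorAct (LinearMap.mul k (TensorAlgebra k V) ∘ₗ TensorAlgebra.ι k) ∘ₗ
      Y.coact

/-- The comultiplication of `T(V)`: the algebra map to the braided tensor product algebra
`T(V) ⊗ T(V)` with `Δ(v) = v ⊗ 1 + 1 ⊗ v` for `v ∈ V`, i.e.
`Δ(v₁ ⋯ vₙ) = (v₁ ⊗ 1 + 1 ⊗ v₁) ⋯ (vₙ ⊗ 1 + 1 ⊗ vₙ) (1 ⊗ 1)`. -/
def tensorComul : TensorAlgebra k V →ₗ[k] TensorAlgebra k V ⊗[k] TensorAlgebra k V :=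
  (LinearMap.applyₗ ((1 : TensorAlgebra k V) ⊗ₜ[k] (1 : TensorAlgebra k V))) ∘ₗ
    (TensorAlgebra.lift k Y.primMul).toLinearMap

theorem tensorAct_ι (h : H) (v : V) :
    Y.tensorAct h (TensorAlgebra.ι k v) = TensorAlgebra.ι k (Y.act h v) := by
  simp [tensorAct, tensorActAux]

theorem tensorAct_one (h : H) :
    Y.tensorAct h 1 = algebraMap k _ (Coalgebra.counit (R := k) h) := by
  simp [tensorAct]

theorem tensorAct_mul (h : H) (x y : TensorAlgebra k V) :
    Y.tensorAct h (x * y) = LinearMap.mul' k _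
      (TensorProduct.map (Y.tensorAct.flip x) (Y.tensorAct.flip y)
        (Coalgebra.comul (R := k) h)) := by
  have : ∀ z, Y.tensorAct h z = (Y.tensorActAux z).ofConv h := fun _ => rfl
  rw [this, map_mul, LinearMap.convMul_apply]
  rfl

theorem tensorComul_one : Y.tensorComul 1 = 1 ⊗ₜ[k] 1 := by
  simp [tensorComul]

theorem tensorComul_ι_mul (v : V) (x : TensorAlgebra k V) :
    Y.tensorComul (TensorAlgebra.ι k v * x) = Y.primMul v (Y.tensorComul x) := by
  simp [tensorComul]

theorem primMul_tmul (v : V) (c d : TensorAlgebra k V) :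
    Y.primMul v (c ⊗ₜ[k] d) = (TensorAlgebra.ι k v * c) ⊗ₜ[k] d +
      TensorProduct.map (Y.tensorAct.flip c) (LinearMap.mulRight k d ∘ₗ TensorAlgebra.ι k)
        (Y.coact v) := by
  simp only [primMul, LinearMap.add_apply, LinearMap.comp_apply]
  congr 1
  induction Y.coact v with
  | zero => simp
  | tmul h w => simp
  | add x y hx hy => simp only [map_add, LinearMap.add_apply, hx, hy]

/-- The graded pieces `V^{⊗ n}` of `T(V)`. -/
abbrev tensorGrade (k V : Type*) [Field k] [AddCommGroup V] [Module k V] (n : ℕ) :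
    Submodule k (TensorAlgebra k V) :=
  LinearMap.range (TensorAlgebra.ι k : V →ₗ[k] TensorAlgebra k V) ^ n

/-- The inclusion of an ideal of `T(V)`, as a `k`-linear map. -/
abbrev incl (J : Ideal (TensorAlgebra k V)) : J.restrictScalars k →ₗ[k] TensorAlgebra k V :=
  (J.restrictScalars k).subtype

/-- Two-sided homogeneous ideals `J` of `T(V)`, contained in `⨁_{n ≥ 2} V^{⊗ n}`, that are
coideals and Yetter–Drinfeld submodules. -/
structure IsNicholsIdeal (J : Ideal (TensorAlgebra k V)) : Prop where
  twoSided : J.IsTwoSided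
  homogeneous : J.IsHomogeneous (tensorGrade k V)
  degree_zero : ∀ x ∈ J, GradedRing.proj (tensorGrade k V) 0 x = 0
  degree_one : ∀ x ∈ J, GradedRing.proj (tensorGrade k V) 1 x = 0
  /-- `Δ(J) ⊆ J ⊗ T(V) + T(V) ⊗ J` -/
  comul_mem : ∀ x ∈ J, Y.tensorComul x ∈
    LinearMap.range ((incl J).rTensor (TensorAlgebra k V)) ⊔
      LinearMap.range ((incl J).lTensor (TensorAlgebra k V))
  act_mem : ∀ (h : H), ∀ x ∈ J, Y.tensorAct h x ∈ J
  /-- `δ(J) ⊆ H ⊗ J` -/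
  coact_mem : ∀ x ∈ J, Y.tensorCoact x ∈ LinearMap.range ((incl J).lTensor H)

/-- The ideal defining the Nichols algebra: the sum of all ideals as in `IsNicholsIdeal`. -/
def nicholsIdeal : Ideal (TensorAlgebra k V) := sSup {J | Y.IsNicholsIdeal J}

theorem le_nicholsIdeal {J : Ideal (TensorAlgebra k V)} (hJ : Y.IsNicholsIdeal J) :
    J ≤ Y.nicholsIdeal := le_sSup hJ

theorem nicholsIdeal_induction {P : TensorAlgebra k V → Prop}
    (mem : ∀ J, Y.IsNicholsIdeal J → ∀ x ∈ J, P x) (zero : P 0)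
    (add : ∀ x y, P x → P y → P (x + y)) (x : TensorAlgebra k V) (hx : x ∈ Y.nicholsIdeal) :
    P x := by
  have hx' : x ∈ ⨆ J : {J // Y.IsNicholsIdeal J}, J.1 := by
    rw [nicholsIdeal, sSup_eq_iSup'] at hx
    exact hx
  exact Submodule.iSup_induction (fun J : {J // Y.IsNicholsIdeal J} => J.1) (motive := P) hx'
    (fun J x hx => mem J.1 J.2 x hx) zero add

theorem range_incl_rTensor_mono (M : Type*) [AddCommGroup M] [Module k M]
    {J J' : Ideal (TensorAlgebra k V)} (h : J ≤ J') :
    LinearMap.range ((incl J).rTensor M) ≤ LinearMap.range ((incl J').rTensor M) := by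
  have : incl J = incl J' ∘ₗ
    Submodule.inclusion (p := J.restrictScalars k) (p' := J'.restrictScalars k) h := rfl
  rw [this, LinearMap.rTensor_comp]
  exact LinearMap.range_comp_le_range _ _

theorem range_incl_lTensor_mono (M : Type*) [AddCommGroup M] [Module k M]
    {J J' : Ideal (TensorAlgebra k V)} (h : J ≤ J') :
    LinearMap.range ((incl J).lTensor M) ≤ LinearMap.range ((incl J').lTensor M) := by
  have : incl J = incl J' ∘ₗ
    Submodule.inclusion (p := J.restrictScalars k) (p' := J'.restrictScalars k) h := rfl
  rw [this, LinearMap.lTensor_comp]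
  exact LinearMap.range_comp_le_range _ _

/-- The sum of all such ideals is such an ideal, hence the largest one. -/
theorem isNicholsIdeal_nicholsIdeal : Y.IsNicholsIdeal Y.nicholsIdeal where
  twoSided := ⟨fun {a} b ha => Y.nicholsIdeal_induction (P := fun x => x * b ∈ Y.nicholsIdeal)
    (fun J hJ x hx => Y.le_nicholsIdeal hJ (hJ.twoSided.mul_mem_of_left b hx))
    (by simp) (fun x y hx hy => by rw [add_mul]; exact add_mem hx hy) a ha⟩
  homogeneous := Ideal.IsHomogeneous.sSup fun _ hJ => hJ.homogeneous
  degree_zero := Y.nicholsIdeal_induction (fun _ hJ => hJ.degree_zero) (by simp)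
    (fun x y hx hy => by rw [map_add, hx, hy, add_zero])
  degree_one := Y.nicholsIdeal_induction (fun _ hJ => hJ.degree_one) (by simp)
    (fun x y hx hy => by rw [map_add, hx, hy, add_zero])
  comul_mem := Y.nicholsIdeal_induction
    (fun _ hJ x hx => sup_le_sup (range_incl_rTensor_mono _ (Y.le_nicholsIdeal hJ))
      (range_incl_lTensor_mono _ (Y.le_nicholsIdeal hJ)) (hJ.comul_mem x hx))
    (by simp) (fun x y hx hy => by rw [map_add]; exact add_mem hx hy)
  act_mem h := Y.nicholsIdeal_induction
    (fun _ hJ x hx => Y.le_nicholsIdeal hJ (hJ.act_mem h x hx))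
    (by simp) (fun x y hx hy => by rw [map_add]; exact add_mem hx hy)
  coact_mem := Y.nicholsIdeal_induction
    (fun _ hJ x hx => range_incl_lTensor_mono _ (Y.le_nicholsIdeal hJ) (hJ.coact_mem x hx))
    (by simp) (fun x y hx hy => by rw [map_add]; exact add_mem hx hy)

instance : Y.nicholsIdeal.IsTwoSided := Y.isNicholsIdeal_nicholsIdeal.twoSided

/-- The Nichols algebra `𝓑(V)`, as an algebra. -/
abbrev Nichols : Type _ := TensorAlgebra k V ⧸ Y.nicholsIdeal

/-- The projection `T(V) → 𝓑(V)`. -/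
def nicholsMk : TensorAlgebra k V →ₐ[k] Y.Nichols := Ideal.Quotient.mkₐ k Y.nicholsIdeal

theorem nicholsMk_eq_zero {x : TensorAlgebra k V} (hx : x ∈ Y.nicholsIdeal) :
    Y.nicholsMk x = 0 := Ideal.Quotient.eq_zero_iff_mem.2 hx

theorem nicholsMk_comp_incl : Y.nicholsMk.toLinearMap ∘ₗ incl Y.nicholsIdeal = 0 :=
  LinearMap.ext fun x => Y.nicholsMk_eq_zero x.2

/-- A `k`-linear map on `T(V)` that vanishes on the defining ideal descends to `𝓑(V)`. -/
def descend {M : Type*} [AddCommGroup M] [Module k M] (f : TensorAlgebra k V →ₗ[k] M)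
    (hf : ∀ x ∈ Y.nicholsIdeal, f x = 0) : Y.Nichols →ₗ[k] M :=
  (Submodule.liftQ (Y.nicholsIdeal.restrictScalars k) f hf) ∘ₗ
    (Submodule.Quotient.restrictScalarsEquiv k Y.nicholsIdeal).symm.toLinearMap

@[simp] theorem descend_mk {M : Type*} [AddCommGroup M] [Module k M]
    (f : TensorAlgebra k V →ₗ[k] M) (hf : ∀ x ∈ Y.nicholsIdeal, f x = 0) (x : TensorAlgebra k V) :
    Y.descend f hf (Y.nicholsMk x) = f x := rfl

/-- The action of `H` on `𝓑(V)`. -/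
def nicholsAct (h : H) : Y.Nichols →ₗ[k] Y.Nichols :=
  Y.descend (Y.nicholsMk.toLinearMap ∘ₗ Y.tensorAct h)
    fun x hx => Y.nicholsMk_eq_zero (Y.isNicholsIdeal_nicholsIdeal.act_mem h x hx)

/-- The coaction of `H` on `𝓑(V)`. -/
def nicholsCoact : Y.Nichols →ₗ[k] H ⊗[k] Y.Nichols :=
  Y.descend (Y.nicholsMk.toLinearMap.lTensor H ∘ₗ Y.tensorCoact.toLinearMap) fun x hx => by
    obtain ⟨t, ht⟩ := Y.isNicholsIdeal_nicholsIdeal.coact_mem x hx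
    simp only [LinearMap.comp_apply, AlgHom.toLinearMap_apply, ← ht]
    rw [← LinearMap.comp_apply, ← LinearMap.lTensor_comp, nicholsMk_comp_incl]
    simp

/-- The comultiplication of `𝓑(V)`. -/
def nicholsComul : Y.Nichols →ₗ[k] Y.Nichols ⊗[k] Y.Nichols :=
  Y.descend (TensorProduct.map Y.nicholsMk.toLinearMap Y.nicholsMk.toLinearMap ∘ₗ Y.tensorComul)
    fun x hx => by
      obtain ⟨_, ⟨s, rfl⟩, _, ⟨t, rfl⟩, hst⟩ :=
        Submodule.mem_sup.1 (Y.isNicholsIdeal_nicholsIdeal.comul_mem x hx)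
      simp only [LinearMap.comp_apply, ← hst, map_add, LinearMap.lTensor, LinearMap.rTensor]
      rw [← LinearMap.comp_apply, ← TensorProduct.map_comp, ← LinearMap.comp_apply,
        ← TensorProduct.map_comp, nicholsMk_comp_incl]
      simp

theorem algebraMapInv_eq (x : TensorAlgebra k V) :
    TensorAlgebra.algebraMapInv x =
      TensorAlgebra.algebraMapInv (GradedRing.proj (tensorGrade k V) 0 x) := by
  induction x using DirectSum.Decomposition.inductionOn (tensorGrade k V) with
  | zero => simp
  | add x y hx hy => rw [map_add, map_add, map_add, hx, hy]
  | @homogeneous i m =>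
    rw [GradedRing.proj_apply]
    rcases Nat.eq_zero_or_pos i with rfl | hi
    · rw [DirectSum.decompose_of_mem_same _ m.2]
    · rw [DirectSum.decompose_of_mem_ne _ m.2 hi.ne', map_zero]
      obtain ⟨j, rfl⟩ := Nat.exists_eq_succ_of_ne_zero hi.ne'
      obtain ⟨m, hm⟩ := m
      simp only
      rw [tensorGrade, Nat.succ_eq_add_one, pow_succ] at hm
      induction hm using Submodule.mul_induction_on' with
      | mem_mul_mem a ha b hb =>
        obtain ⟨v, rfl⟩ := hb
        simp [TensorAlgebra.algebraMapInv]
      | add a ha b hb h1 h2 => rw [map_add, h1, h2, add_zero]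

/-- The counit of `𝓑(V)`: the augmentation which vanishes on `V`. -/
def nicholsCounit : Y.Nichols →ₗ[k] k :=
  Y.descend (TensorAlgebra.algebraMapInv (R := k) (M := V)).toLinearMap fun x hx => by
    rw [AlgHom.toLinearMap_apply, algebraMapInv_eq,
      Y.isNicholsIdeal_nicholsIdeal.degree_zero x hx, map_zero]

/-- The graded pieces of `𝓑(V)`. -/
def nicholsGrade (n : ℕ) : Submodule k Y.Nichols :=
  (tensorGrade k V n).map Y.nicholsMk.toLinearMap

/-- A pull-push isomorphism `(φ, ψ)` of graded braided Hopf algebras from the Nichols algebra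
`𝓑(V)` over `H` to the Nichols algebra `𝓑(V')` over `H'`: `ψ` is an isomorphism of graded
algebras and coalgebras, a left `H`-module map to the pullback of `𝓑(V')` along `φ` and a left
`H'`-comodule map from the pushout of `𝓑(V)` along `φ`. (Such a `ψ` automatically respects the
antipodes, which are convolution inverses of the identity maps.) -/
structure NicholsPullPushIso (Y : YetterDrinfeld k H V) (Y' : YetterDrinfeld k H' V')
    (φ : H ≃ₐc[k] H') where
  /-- the underlying isomorphism of algebras `ψ` -/
  ψ : Y.Nichols ≃ₐ[k] Y'.Nichols
  map_grade : ∀ n, (Y.nicholsGrade n).map ψ.toLinearMap = Y'.nicholsGrade n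
  map_comul : ∀ x, TensorProduct.map ψ.toLinearMap ψ.toLinearMap (Y.nicholsComul x) =
    Y'.nicholsComul (ψ x)
  map_counit : ∀ x, Y'.nicholsCounit (ψ x) = Y.nicholsCounit x
  map_act : ∀ (h : H) (x : Y.Nichols), ψ (Y.nicholsAct h x) = Y'.nicholsAct (φ h) (ψ x)
  map_coact : ∀ x, TensorProduct.map (φ : H →ₗ[k] H') ψ.toLinearMap (Y.nicholsCoact x) =
    Y'.nicholsCoact (ψ x)

end YetterDrinfeld

/-! ### Ramification systems with irreducible representations -/

universe uk uG uI uX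

/-- A ramification system with irreducible representations (RSR) of `G`. All representations are
right representations, i.e. representations of the opposite group. The index sets `I C` are given
for all conjugacy classes `C`; they are empty exactly when `r C = 0`, see `RSR.isEmpty_iff`. -/
structure RSR (k : Type uk) (G : Type uG) [Field k] [Group G] where
  /-- the ramification `r = ∑ r_C C` -/
  r : ConjClasses G → Cardinal.{uI}
  /-- a choice of elements of the conjugacy classes -/
  u : ConjClasses G → G
  mk_u : ∀ C, ConjClasses.mk (u C) = C
  /-- the index set `I_C(r, u)` -/
  I : ConjClasses G → Type uI
  /-- the index sets `J_C(i)` -/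
  J : ∀ C, I C → Type uI
  /-- the space of the representation `ρ_C^{(i)}` -/
  X : ∀ C, I C → Type uX
  [addCommGroup : ∀ C i, AddCommGroup (X C i)]
  [module : ∀ C i, Module k (X C i)]
  /-- the right representation `ρ_C^{(i)}` of the centralizer of `u(C)`;
  `ρ C i (op z) x` stands for `x · z` -/
  ρ : ∀ C i, Representation k (Subgroup.centralizer {u C})ᵐᵒᵖ (X C i)
  irreducible : ∀ C i, (ρ C i).IsIrreducible
  /-- `|J_C(i)| = deg ρ_C^{(i)}` -/
  mk_J : ∀ C i, Cardinal.lift.{uX} (Cardinal.mk (J C i)) =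
    Cardinal.lift.{uI} (Module.rank k (X C i))
  /-- `I_C(r) = {(i, j) | i ∈ I_C(r, u), j ∈ J_C(i)}` has cardinality `r_C` -/
  mk_I : ∀ C, Cardinal.mk (Σ i : I C, J C i) = r C

namespace RSR

attribute [instance] RSR.addCommGroup RSR.module

open MulOpposite

variable {k : Type uk} {G : Type uG} [Field k] [Group G]

/-- The centralizer `Z_{u(C)}`. -/
abbrev Z (D : RSR k G) (C : ConjClasses G) : Subgroup G := Subgroup.centralizer {D.u C}

theorem mem_Z {D : RSR k G} {C : ConjClasses G} {z : G} : z ∈ D.Z C ↔ z * D.u C = D.u C * z := by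
  rw [Subgroup.mem_centralizer_singleton_iff]

theorem nonempty_J (D : RSR k G) (C : ConjClasses G) (i : D.I C) : Nonempty (D.J C i) := by
  have := D.irreducible C i
  rw [← Cardinal.mk_ne_zero_iff]
  intro h0
  have h1 := D.mk_J C i
  rw [h0, Cardinal.lift_zero, eq_comm, Cardinal.lift_eq_zero, rank_zero_iff] at h1
  obtain ⟨a, b, hab⟩ := exists_pair_ne (Subrepresentation (D.ρ C i))
  exact hab (SetLike.ext fun x => by
    rw [Subsingleton.elim x 0]
    exact iff_of_true a.toSubmodule.zero_mem b.toSubmodule.zero_mem)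

/-- No representations are attached to the classes outside the support of the ramification. -/
theorem isEmpty_iff (D : RSR k G) (C : ConjClasses G) : IsEmpty (D.I C) ↔ D.r C = 0 := by
  rw [← D.mk_I C, Cardinal.mk_eq_zero_iff, isEmpty_sigma]
  refine ⟨fun h i => h.elim i, fun h => ⟨fun i => ?_⟩⟩
  obtain ⟨j⟩ := D.nonempty_J C i
  exact (h i).elim j

section Iso

variable {G' : Type*} [Group G']

/-- For an isomorphism `φ : G ≃ G'` and `h ∈ G` with `φ(h⁻¹ u(C) h) = u'(φ(C))`, the restriction
`Z_{u(C)} → Z_{u'(φ(C))}` of `φ_h : x ↦ φ(h⁻¹ x h)`. -/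
def centralizerMap (D : RSR k G) (D' : RSR k G') (φ : G ≃* G') (C : ConjClasses G) (h : G)
    (hh : φ (h⁻¹ * D.u C * h) = D'.u (ConjClasses.map φ.toMonoidHom C)) :
    D.Z C →* D'.Z (ConjClasses.map φ.toMonoidHom C) where
  toFun z := ⟨φ (h⁻¹ * z * h), by
    rw [mem_Z, ← hh, ← map_mul, ← map_mul]
    congr 1
    have := mem_Z.1 z.2
    calc h⁻¹ * z * h * (h⁻¹ * D.u C * h) = h⁻¹ * (z * D.u C) * h := by group
      _ = h⁻¹ * (D.u C * z) * h := by rw [this]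
      _ = h⁻¹ * D.u C * h * (h⁻¹ * z * h) := by group⟩
  map_one' := by ext; simp
  map_mul' z w := by
    ext
    simp only [Subgroup.coe_mul, ← map_mul]
    congr 1
    group

/-- An isomorphism of RSR's. -/
structure Iso (D : RSR k G) (D' : RSR k G') where
  /-- the group isomorphism `φ` -/
  φ : G ≃* G'
  /-- the elements `h_C` -/
  h : ConjClasses G → G
  map_u : ∀ C, φ ((h C)⁻¹ * D.u C * h C) = D'.u (ConjClasses.map φ.toMonoidHom C)
  /-- the bijections `φ_C : I_C(r, u) → I_{φ(C)}(r', u')` -/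
  e : ∀ C, D.I C ≃ D'.I (ConjClasses.map φ.toMonoidHom C)
  /-- the isomorphisms `ρ_C^{(i)} ≅ ρ'_{φ(C)}^{(φ_C(i))} φ_{h_C}` -/
  ξ : ∀ C i, D.X C i ≃ₗ[k] D'.X (ConjClasses.map φ.toMonoidHom C) (e C i)
  map_ρ : ∀ C i (z : D.Z C) (x : D.X C i),
    ξ C i (D.ρ C i (op z) x) =
      D'.ρ _ (e C i) (op (D.centralizerMap D' φ C (h C) (map_u C) z)) (ξ C i x)

end Iso

/-! ### The Hopf quiver -/

/-- The arrows `a_{y,x}^{(i,j)}` of the Hopf quiver of the ramification `r`, where `x = src`,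
`y = tgt` are vertices, `x⁻¹ y ∈ C = cls` and `(i, j) ∈ I_C(r)`. The set of vertices is `G`. -/
@[ext] structure Arrow (D : RSR k G) where
  src : G
  tgt : G
  cls : ConjClasses G
  cls_eq : ConjClasses.mk (src⁻¹ * tgt) = cls
  i : D.I cls
  j : D.J cls i

/-- The set `Q_1^1` of arrows starting at `1`. -/
abbrev Arrow1 (D : RSR k G) : Type _ := {a : D.Arrow // a.src = 1}

/-- The choices that enter the construction of the arrow bimodules: coset representatives
for the centralizers `Z_{u(C)}` and bases of the representation spaces. The right cosets of
`Z_{u(C)}` in `G` correspond to the elements of `C` through `Z_{u(C)} g ↦ g⁻¹ u(C) g`, and they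
are indexed by the elements of `C` here; see `Frame.existsUnique_coset`. -/
structure Frame (D : RSR k G) where
  /-- `rep c` is the representative `g_θ` of the coset with `g_θ⁻¹ u(C) g_θ = c` -/
  rep : G → G
  rep_spec : ∀ c, (rep c)⁻¹ * D.u (ConjClasses.mk c) * rep c = c
  /-- the coset `Z_{u(C)}` is represented by `1` -/
  rep_u : ∀ C, rep (D.u C) = 1
  /-- the basis `x_C^{(i,j)}`, `j ∈ J_C(i)`, of the space of `ρ_C^{(i)}` -/
  basis : ∀ C i, Module.Basis (D.J C i) k (D.X C i)

namespace Frame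

variable {D : RSR k G} (F : D.Frame)

theorem u_mul_rep {c : G} {C : ConjClasses G} (hc : ConjClasses.mk c = C) :
    D.u C * F.rep c = F.rep c * c := by
  subst hc
  have h1 := F.rep_spec c
  rw [mul_assoc, inv_mul_eq_iff_eq_mul] at h1
  exact h1

theorem mk_conj (c h : G) : ConjClasses.mk (h⁻¹ * c * h) = ConjClasses.mk c :=
  ConjClasses.mk_eq_mk_iff_isConj.2 (isConj_iff.2 ⟨h, by group⟩)

/-- The elements `rep c` with `c ∈ C` represent the right cosets of `Z_{u(C)}` in `G`. -/
theorem existsUnique_coset (C : ConjClasses G) (g : G) :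
    ∃! c, ConjClasses.mk c = C ∧ ∃ z ∈ D.Z C, g = z * F.rep c := by
  have hu : ConjClasses.mk (g⁻¹ * D.u C * g) = C := by rw [mk_conj, D.mk_u]
  refine ⟨g⁻¹ * D.u C * g, ⟨hu, g * (F.rep (g⁻¹ * D.u C * g))⁻¹, ?_, by group⟩, ?_⟩
  · have h := F.u_mul_rep hu
    set b := F.rep (g⁻¹ * D.u C * g)
    rw [mem_Z]
    have h' : b⁻¹ * D.u C = g⁻¹ * D.u C * g * b⁻¹ := by
      rw [inv_mul_eq_iff_eq_mul, ← mul_assoc, ← h]; group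
    rw [mul_assoc, h']
    group
  · rintro c ⟨hc, z, hz, rfl⟩
    have h := F.u_mul_rep hc
    rw [mem_Z] at hz
    have : c = (F.rep c)⁻¹ * D.u C * F.rep c := by rw [mul_assoc, h]; group
    rw [mul_inv_rev, mul_assoc, mul_assoc, ← mul_assoc (D.u C), ← hz]
    conv_lhs => rw [this]
    group

/-- The element `ζ_θ(h) ∈ Z_{u(C)}` with `g_θ h = ζ_θ(h) g_θ'`. If `g_θ` belongs to `c`, then
`g_θ'` belongs to `h⁻¹ c h`. -/
def ζ (C : ConjClasses G) (c : G) (hc : ConjClasses.mk c = C) (h : G) : D.Z C :=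
  ⟨F.rep c * h * (F.rep (h⁻¹ * c * h))⁻¹, by
    have h1 := F.u_mul_rep hc
    have h2 := F.u_mul_rep ((mk_conj c h).trans hc)
    rw [mem_Z]
    set b := F.rep (h⁻¹ * c * h)
    have h' : b⁻¹ * D.u C = h⁻¹ * c * h * b⁻¹ := by
      rw [inv_mul_eq_iff_eq_mul, ← mul_assoc, ← h2]; group
    rw [mul_assoc, h', ← mul_assoc, ← mul_assoc (D.u C), ← mul_assoc (D.u C), h1]
    group⟩

theorem ζ_one (C : ConjClasses G) (c : G) (hc : ConjClasses.mk c = C) : F.ζ C c hc 1 = 1 := by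
  ext
  simp [ζ]

theorem ζ_mul (C : ConjClasses G) (c c' : G) (hc : ConjClasses.mk c = C)
    (hc' : ConjClasses.mk c' = C) (h h' : G) (hcc' : c' = h⁻¹ * c * h) :
    F.ζ C c hc (h * h') = F.ζ C c hc h * F.ζ C c' hc' h' := by
  subst hcc'
  ext
  have : (h * h')⁻¹ * c * (h * h') = h'⁻¹ * (h⁻¹ * c * h) * h' := by group
  simp only [ζ, Subgroup.coe_mul, this]
  group

theorem nonempty (D : RSR k G) : Nonempty D.Frame := by
  have h1 : ∀ c : G, ∃ g : G, g⁻¹ * D.u (ConjClasses.mk c) * g = c ∧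
      (c = D.u (ConjClasses.mk c) → g = 1) := by
    intro c
    by_cases hc : c = D.u (ConjClasses.mk c)
    · refine ⟨1, ?_, fun _ => rfl⟩
      simpa using hc.symm
    · obtain ⟨g, hg⟩ := isConj_iff.1 (ConjClasses.mk_eq_mk_iff_isConj.1 (D.mk_u (ConjClasses.mk c)))
      exact ⟨g⁻¹, by simpa using hg, fun h => absurd h hc⟩
  choose rep hrep hrep1 using h1
  refine ⟨⟨rep, hrep, fun C => hrep1 _ (by rw [D.mk_u]), fun C i => ?_⟩⟩
  have b := Module.Free.chooseBasis k (D.X C i)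
  have h2 := D.mk_J C i
  rw [← b.mk_eq_rank''] at h2
  exact b.reindex (Classical.choice (Cardinal.lift_mk_eq'.1 h2)).symm

end Frame

/-! ### The arrow bimodules -/

namespace Arrow

variable {D : RSR k G}

/-- `h · a_{y,x}^{(i,j)} = a_{hy,hx}^{(i,j)}`. -/
def lmul (h : G) (a : D.Arrow) : D.Arrow where
  src := h * a.src
  tgt := h * a.tgt
  cls := a.cls
  cls_eq := by rw [← a.cls_eq]; congr 1; group
  i := a.i
  j := a.j

/-- The arrow `a_{yh,xh}^{(i,s)}` obtained from `a_{y,x}^{(i,j)}`. -/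
def rmul (a : D.Arrow) (h : G) (s : D.J a.cls a.i) : D.Arrow where
  src := a.src * h
  tgt := a.tgt * h
  cls := a.cls
  cls_eq := by
    rw [← a.cls_eq, ← Frame.mk_conj (a.src⁻¹ * a.tgt) h]
    congr 1
    group
  i := a.i
  j := s

end Arrow

namespace Frame

variable {D : RSR k G} (F : D.Frame)

/-- The left `kG`-action on `kQ_1^c`. -/
def lAct (_F : D.Frame) (h : G) : (D.Arrow →₀ k) →ₗ[k] (D.Arrow →₀ k) :=
  Finsupp.lmapDomain k k (Arrow.lmul h)

/-- The right `kG`-action on `kQ_1^c`: `a_{y,x}^{(i,j)} · h = ∑_s k_{C,h}^{(i,j,s)} a_{yh,xh}^{(i,s)}`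
if `x⁻¹ y = g_θ⁻¹ u(C) g_θ` and `x_C^{(i,j)} · ζ_θ(h) = ∑_s k_{C,h}^{(i,j,s)} x_C^{(i,s)}`. -/
def rAct (h : G) : (D.Arrow →₀ k) →ₗ[k] (D.Arrow →₀ k) :=
  Finsupp.linearCombination k fun a : D.Arrow =>
    Finsupp.mapDomain (a.rmul h) ((F.basis a.cls a.i).repr
      (D.ρ a.cls a.i (op (F.ζ a.cls (a.src⁻¹ * a.tgt) a.cls_eq h)) (F.basis a.cls a.i a.j)))

/-- The linear combination of arrows from `x` to `y` with the coordinates of `w`. -/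
def arrowVec (x y : G) (C : ConjClasses G) (hC : ConjClasses.mk (x⁻¹ * y) = C) (i : D.I C) :
    D.X C i →ₗ[k] (D.Arrow →₀ k) :=
  Finsupp.lmapDomain k k (fun s => (⟨x, y, C, hC, i, s⟩ : D.Arrow)) ∘ₗ
    (F.basis C i).repr.toLinearMap

theorem arrowVec_basis (x y : G) (C : ConjClasses G) (hC : ConjClasses.mk (x⁻¹ * y) = C)
    (i : D.I C) (j : D.J C i) :
    F.arrowVec x y C hC i (F.basis C i j) = Finsupp.single ⟨x, y, C, hC, i, j⟩ 1 := by
  simp [arrowVec, Finsupp.mapDomain_single]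

theorem arrowVec_congr {x y x' y' : G} {C : ConjClasses G} {hC : ConjClasses.mk (x⁻¹ * y) = C}
    {hC' : ConjClasses.mk (x'⁻¹ * y') = C} {i : D.I C} {w w' : D.X C i} (hx : x = x') (hy : y = y')
    (hw : w = w') : F.arrowVec x y C hC i w = F.arrowVec x' y' C hC' i w' := by
  subst hx hy hw
  rfl

theorem mk_rmul {x y : G} {C : ConjClasses G} (hC : ConjClasses.mk (x⁻¹ * y) = C) (h : G) :
    ConjClasses.mk ((x * h)⁻¹ * (y * h)) = C := by
  rw [← hC, ← mk_conj (x⁻¹ * y) h]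
  congr 1
  group

theorem mk_lmul {x y : G} {C : ConjClasses G} (hC : ConjClasses.mk (x⁻¹ * y) = C) (h : G) :
    ConjClasses.mk ((h * x)⁻¹ * (h * y)) = C := by
  rw [← hC]
  congr 1
  group

theorem lAct_arrowVec (h x y : G) (C : ConjClasses G) (hC : ConjClasses.mk (x⁻¹ * y) = C)
    (i : D.I C) (w : D.X C i) :
    F.lAct h (F.arrowVec x y C hC i w) = F.arrowVec (h * x) (h * y) C (mk_lmul hC h) i w := by
  simp only [lAct, arrowVec, LinearMap.comp_apply, Finsupp.lmapDomain_apply,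
    ← Finsupp.mapDomain_comp]
  rfl

theorem rAct_arrowVec (h x y : G) (C : ConjClasses G) (hC : ConjClasses.mk (x⁻¹ * y) = C)
    (i : D.I C) (w : D.X C i) :
    F.rAct h (F.arrowVec x y C hC i w) = F.arrowVec (x * h) (y * h) C (mk_rmul hC h) i
      (D.ρ C i (op (F.ζ C (x⁻¹ * y) hC h)) w) := by
  have : F.rAct h ∘ₗ F.arrowVec x y C hC i = F.arrowVec (x * h) (y * h) C (mk_rmul hC h) i ∘ₗ
      D.ρ C i (op (F.ζ C (x⁻¹ * y) hC h)) := by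
    refine (F.basis C i).ext fun j => ?_
    simp only [LinearMap.comp_apply, arrowVec_basis, rAct, Finsupp.linearCombination_single,
      one_smul]
    rfl
  exact LinearMap.congr_fun this w

theorem hom_ext_arrowVec {M : Type*} [AddCommMonoid M] [Module k M]
    {S T : (D.Arrow →₀ k) →ₗ[k] M}
    (h : ∀ (x y : G) (C : ConjClasses G) (hC : ConjClasses.mk (x⁻¹ * y) = C) (i : D.I C)
      (w : D.X C i), S (F.arrowVec x y C hC i w) = T (F.arrowVec x y C hC i w)) : S = T := by
  refine Finsupp.lhom_ext' fun a => LinearMap.ext_ring ?_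
  have := h a.src a.tgt a.cls a.cls_eq a.i (F.basis a.cls a.i a.j)
  rw [arrowVec_basis] at this
  exact this

theorem lAct_one : F.lAct 1 = LinearMap.id := F.hom_ext_arrowVec fun x y C hC i w => by
  rw [lAct_arrowVec]
  exact F.arrowVec_congr (one_mul _) (one_mul _) rfl

theorem lAct_mul (g h : G) : F.lAct (g * h) = F.lAct g ∘ₗ F.lAct h :=
  F.hom_ext_arrowVec fun x y C hC i w => by
    simp only [LinearMap.comp_apply, lAct_arrowVec]
    exact F.arrowVec_congr (mul_assoc _ _ _) (mul_assoc _ _ _) rfl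

theorem rAct_one : F.rAct 1 = LinearMap.id := F.hom_ext_arrowVec fun x y C hC i w => by
  rw [rAct_arrowVec]
  refine F.arrowVec_congr (mul_one _) (mul_one _) ?_
  rw [ζ_one, op_one, map_one]
  rfl

theorem rAct_mul (g h : G) : F.rAct (g * h) = F.rAct h ∘ₗ F.rAct g :=
  F.hom_ext_arrowVec fun x y C hC i w => by
    simp only [LinearMap.comp_apply, rAct_arrowVec]
    refine F.arrowVec_congr (mul_assoc _ _ _).symm (mul_assoc _ _ _).symm ?_
    rw [F.ζ_mul C (x⁻¹ * y) ((x * g)⁻¹ * (y * g)) hC (mk_rmul hC g) g h (by group), op_mul,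
      map_mul]
    rfl

theorem lAct_rAct (g h : G) : F.lAct g ∘ₗ F.rAct h = F.rAct h ∘ₗ F.lAct g :=
  F.hom_ext_arrowVec fun x y C hC i w => by
    simp only [LinearMap.comp_apply, lAct_arrowVec, rAct_arrowVec]
    refine F.arrowVec_congr (mul_assoc _ _ _).symm (mul_assoc _ _ _).symm ?_
    congr 4
    group

end Frame
end RSR

/-! ### Yetter–Drinfeld modules over `(kG)^*` on spaces of functions -/

namespace DualGroupAlg

variable {k G ι : Type*} [Field k] [Group G] [Fintype G]

/-- The action of `(kG)^*` on functions on a `G`-graded set: `p_g` projects to degree `g`. -/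
def degAct (deg : ι → G) : DualGroupAlg k G →ₐ[k] Module.End k (ι → k) :=
  (Algebra.lmul k (ι → k)).comp
    (AlgHom.pi fun a => eval (deg a))

@[simp] theorem degAct_apply (deg : ι → G) (f : DualGroupAlg k G) (v : ι → k) (a : ι) :
    degAct deg f v a = f (deg a) * v a := rfl

/-- The coaction `v ↦ ∑_g p_g ⊗ T_g v`. -/
def coactOf {V : Type*} [AddCommGroup V] [Module k V] (T : G → Module.End k V) :
    V →ₗ[k] DualGroupAlg k G ⊗[k] V :=
  ∑ g, TensorProduct.mk k _ _ (p g) ∘ₗ T g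

theorem evalL_coactOf {V : Type*} [AddCommGroup V] [Module k V] (T : G → Module.End k V)
    (g : G) (v : V) : evalL g (coactOf T v) = T g v := by
  simp only [coactOf, LinearMap.sum_apply, map_sum, LinearMap.comp_apply, TensorProduct.mk_apply,
    evalL_tmul, p_apply, ite_smul, one_smul, zero_smul, sum_ite_p]

theorem evalL_assoc_comul {V : Type*} [AddCommGroup V] [Module k V] (a b : G) :
    evalL b ∘ₗ evalL a ∘ₗ (TensorProduct.assoc k (DualGroupAlg k G) (DualGroupAlg k G) V).toLinearMap
      ∘ₗ (Coalgebra.comul (R := k) (A := DualGroupAlg k G)).rTensor V = evalL (a * b) := by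
  refine TensorProduct.ext' fun x y => ?_
  simp only [LinearMap.comp_apply, LinearEquiv.coe_coe, comul_eq, LinearMap.rTensor_tmul,
    TensorProduct.sum_tmul, map_sum, TensorProduct.assoc_tmul,
    evalL_tmul, p_apply, ite_smul, one_smul, zero_smul, sum_ite_p, shift_apply]

theorem evalL_lTensor {V W : Type*} [AddCommGroup V] [Module k V] [AddCommGroup W] [Module k W]
    (T : V →ₗ[k] W) (g : G) (t : DualGroupAlg k G ⊗[k] V) :
    evalL g (T.lTensor (DualGroupAlg k G) t) = T (evalL g t) := by
  have : evalL g ∘ₗ T.lTensor (DualGroupAlg k G) = T ∘ₗ evalL g :=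
    TensorProduct.ext' fun x y => by simp
  exact LinearMap.congr_fun this t

theorem evalL_compat_left (deg : ι → G) (g : G) :
    evalL g ∘ₗ TensorProduct.map (LinearMap.mul' k _)
        (TensorProduct.lift (degAct (k := k) deg).toLinearMap) ∘ₗ
      (TensorProduct.tensorTensorTensorComm k (DualGroupAlg k G) (DualGroupAlg k G)
        (DualGroupAlg k G) (ι → k)).toLinearMap =
    TensorProduct.lift (degAct deg).toLinearMap ∘ₗ TensorProduct.map (evalL g) (evalL g) := by
  refine TensorProduct.ext_fourfold' fun w x y z => ?_
  simp only [LinearMap.comp_apply, LinearEquiv.coe_coe,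
    TensorProduct.tensorTensorTensorComm_tmul, TensorProduct.map_tmul, LinearMap.mul'_apply,
    TensorProduct.lift.tmul, evalL_tmul, mul_apply, map_smul, LinearMap.smul_apply, smul_smul,
    mul_comm]

theorem evalL_mul_rightComm {V : Type*} [AddCommGroup V] [Module k V] (g : G)
    (s : DualGroupAlg k G ⊗[k] V) (y : DualGroupAlg k G) :
    evalL g ((LinearMap.mul' k (DualGroupAlg k G)).rTensor V
      (TensorProduct.rightComm k (DualGroupAlg k G) V (DualGroupAlg k G) (s ⊗ₜ[k] y))) =
      y g • evalL g s := by
  have : evalL g ∘ₗ (LinearMap.mul' k (DualGroupAlg k G)).rTensor V ∘ₗ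
      (TensorProduct.rightComm k (DualGroupAlg k G) V (DualGroupAlg k G)).toLinearMap ∘ₗ
      (TensorProduct.mk k (DualGroupAlg k G ⊗[k] V) (DualGroupAlg k G)).flip y =
      y g • evalL g :=
    TensorProduct.ext' fun x v => by
      simp only [LinearMap.comp_apply, LinearMap.flip_apply, TensorProduct.mk_apply,
        LinearEquiv.coe_coe, TensorProduct.rightComm_tmul, LinearMap.rTensor_tmul,
        LinearMap.mul'_apply, evalL_tmul, mul_apply, LinearMap.smul_apply, smul_smul, mul_comm]
  exact LinearMap.congr_fun this s

theorem evalL_compat_right (deg : ι → G) (T : G → Module.End k (ι → k))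
    (T_deg : ∀ (g : G) (f : DualGroupAlg k G) (v : ι → k) (a : ι),
      T g (degAct deg f v) a = f (g * deg a * g⁻¹) * T g v a) (g : G) (v : ι → k) (a : ι)
    (t : DualGroupAlg k G ⊗[k] DualGroupAlg k G) :
    evalL g ((LinearMap.mul' k (DualGroupAlg k G)).rTensor (ι → k)
      (TensorProduct.rightComm k (DualGroupAlg k G) (ι → k) (DualGroupAlg k G)
        ((coactOf T ∘ₗ TensorProduct.lift (degAct (k := k) deg).toLinearMap).rTensor
          (DualGroupAlg k G)
          (TensorProduct.rightComm k (DualGroupAlg k G) (DualGroupAlg k G) (ι → k)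
            (t ⊗ₜ[k] v))))) a =
      evalL (g * deg a * g⁻¹) t g * T g v a := by
  have : LinearMap.proj a ∘ₗ evalL g ∘ₗ (LinearMap.mul' k (DualGroupAlg k G)).rTensor (ι → k) ∘ₗ
      (TensorProduct.rightComm k (DualGroupAlg k G) (ι → k) (DualGroupAlg k G)).toLinearMap ∘ₗ
      (coactOf T ∘ₗ TensorProduct.lift (degAct (k := k) deg).toLinearMap).rTensor
          (DualGroupAlg k G) ∘ₗ
      (TensorProduct.rightComm k (DualGroupAlg k G) (DualGroupAlg k G) (ι → k)).toLinearMap ∘ₗ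
      (TensorProduct.mk k (DualGroupAlg k G ⊗[k] DualGroupAlg k G) (ι → k)).flip v =
      T g v a • ((eval g).toLinearMap ∘ₗ evalL (g * deg a * g⁻¹)) := by
    refine TensorProduct.ext' fun x y => ?_
    simp only [LinearMap.comp_apply, LinearMap.flip_apply, TensorProduct.mk_apply,
      LinearEquiv.coe_coe, TensorProduct.rightComm_tmul, LinearMap.rTensor_tmul,
      TensorProduct.lift.tmul, evalL_mul_rightComm, evalL_coactOf, LinearMap.proj_apply,
      Pi.smul_apply, AlgHom.toLinearMap_apply, T_deg, LinearMap.smul_apply, evalL_tmul,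
      eval_apply, smul_apply, smul_eq_mul]
    ring
  have h := LinearMap.congr_fun this t
  rw [mul_comm]
  exact h

/-- The Yetter–Drinfeld module over `(kG)^*` given by a `G`-grading and a right action of `G`. -/
def ydOf (deg : ι → G) (T : G → Module.End k (ι → k)) (T_one : T 1 = LinearMap.id)
    (T_mul : ∀ g h, T (g * h) = T h ∘ₗ T g)
    (T_deg : ∀ (g : G) (f : DualGroupAlg k G) (v : ι → k) (a : ι),
      T g (degAct deg f v) a = f (g * deg a * g⁻¹) * T g v a)
    (coact : (ι → k) →ₗ[k] DualGroupAlg k G ⊗[k] (ι → k)) (hcoact : coact = coactOf T) :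
    YetterDrinfeld k (DualGroupAlg k G) (ι → k) where
  act := degAct deg
  coact := coact
  coassoc := by
    subst hcoact
    refine LinearMap.ext fun v => ext_evalL fun a => ext_evalL fun b => ?_
    refine (LinearMap.congr_fun (evalL_assoc_comul a b) (coactOf T v)).trans ?_
    rw [LinearMap.comp_apply, evalL_lTensor, evalL_coactOf, evalL_coactOf, evalL_coactOf, T_mul]
    rfl
  counit_coact := by
    subst hcoact
    have : (TensorProduct.lid k (ι → k)).toLinearMap ∘ₗ
      (Coalgebra.counit (R := k) (A := DualGroupAlg k G)).rTensor (ι → k) = evalL 1 := rfl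
    rw [← LinearMap.comp_assoc, this]
    refine LinearMap.ext fun v => ?_
    rw [LinearMap.comp_apply, evalL_coactOf, T_one]
  compat := by
    subst hcoact
    refine TensorProduct.ext' fun f v => ext_evalL fun g => ?_
    refine (LinearMap.congr_fun (evalL_compat_left deg g)
      (Coalgebra.comul (R := k) f ⊗ₜ[k] coactOf T v)).trans ?_
    funext a
    refine Eq.trans ?_ (evalL_compat_right deg T T_deg g v a (Coalgebra.comul (R := k) f)).symm
    rw [LinearMap.comp_apply, TensorProduct.map_tmul, TensorProduct.lift.tmul,
      AlgHom.toLinearMap_apply, evalL_comul, evalL_comul, evalL_coactOf, degAct_apply,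
      shift_apply, shift_apply, inv_mul_cancel_right]

end DualGroupAlg

/-! ### The dual arrow bimodule and the coadjoint Yetter–Drinfeld module -/

namespace RSR.Frame

open DualGroupAlg MulOpposite

variable {k : Type uk} {G : Type uG} [Field k] [Group G]
variable {D : RSR k G} (F : D.Frame)

/-- The transpose of an endomorphism of `kQ_1^c` with respect to the pairing
`⟨f, v⟩ = ∑_a f(a) v_a` between `kQ_1^a` and `kQ_1^c` for which the arrows are dual bases. Here
`Q` is a finite quiver, and the elements of `kQ_1^a` are written as functions on the set of
arrows; an arrow is identified with the indicator function of itself. -/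
def transpose (T : (D.Arrow →₀ k) →ₗ[k] (D.Arrow →₀ k)) : (D.Arrow → k) →ₗ[k] (D.Arrow → k) where
  toFun f := fun a => Finsupp.linearCombination k f (T (Finsupp.single a 1))
  map_add' f f' := by
    ext a
    simp [Finsupp.linearCombination_apply, Finsupp.sum, mul_add, Finset.sum_add_distrib]
  map_smul' c f := by
    ext a
    simp [Finsupp.linearCombination_apply, Finsupp.sum, Finset.mul_sum, mul_left_comm]

theorem transpose_pairing (T : (D.Arrow →₀ k) →ₗ[k] (D.Arrow →₀ k)) (f : D.Arrow → k)
    (v : D.Arrow →₀ k) : Finsupp.linearCombination k (transpose T f) v =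
      Finsupp.linearCombination k f (T v) := by
  have : Finsupp.linearCombination k (transpose T f) = Finsupp.linearCombination k f ∘ₗ T := by
    ext a
    simp [transpose]
  rw [this, LinearMap.comp_apply]

theorem transpose_comp (S T : (D.Arrow →₀ k) →ₗ[k] (D.Arrow →₀ k)) :
    transpose (S ∘ₗ T) = transpose T ∘ₗ transpose S := by
  ext1 f
  funext a
  have := transpose_pairing S f (T (Finsupp.single a 1))
  exact this.symm

theorem transpose_id : transpose (LinearMap.id : (D.Arrow →₀ k) →ₗ[k] _) = LinearMap.id := by
  ext1 f
  funext a
  simp [transpose]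

variable [Fintype G]

/-- The left `(kG)^*`-coaction on `kQ_1^a`, dual to the left `kG`-action on `kQ_1^c`. -/
def deltaL : (D.Arrow → k) →ₗ[k] DualGroupAlg k G ⊗[k] (D.Arrow → k) :=
  ∑ g, TensorProduct.mk k _ _ (p g) ∘ₗ transpose (F.lAct g)

/-- The right `(kG)^*`-coaction on `kQ_1^a`, dual to the right `kG`-action on `kQ_1^c`. -/
def deltaR : (D.Arrow → k) →ₗ[k] (D.Arrow → k) ⊗[k] DualGroupAlg k G :=
  ∑ g, (TensorProduct.mk k _ _).flip (p g) ∘ₗ transpose (F.rAct g)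

/-- The adjoint coaction `x ↦ x₍₋₁₎ S(x₍₀₎₍₁₎) ⊗ x₍₀₎₍₀₎` on `kQ_1^a`. -/
def deltaCoad : (D.Arrow → k) →ₗ[k] DualGroupAlg k G ⊗[k] (D.Arrow → k) :=
  (LinearMap.mul' k (DualGroupAlg k G) ∘ₗ
      (HopfAlgebra.antipode k).lTensor (DualGroupAlg k G)).rTensor (D.Arrow → k) ∘ₗ
    (TensorProduct.assoc k (DualGroupAlg k G) (DualGroupAlg k G) (D.Arrow → k)).symm.toLinearMap ∘ₗ
    (TensorProduct.comm k (D.Arrow → k) (DualGroupAlg k G)).toLinearMap.lTensor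
      (DualGroupAlg k G) ∘ₗ
    F.deltaR.lTensor (DualGroupAlg k G) ∘ₗ F.deltaL

/-- The transpose of the adjoint action `x ↦ g · x · g⁻¹` on `kQ_1^c`. -/
def coadOp (g : G) : Module.End k (D.Arrow → k) := transpose (F.lAct g ∘ₗ F.rAct g⁻¹)

theorem deltaCoad_eq : F.deltaCoad = coactOf F.coadOp := by
  refine LinearMap.ext fun f => ext_evalL fun g => ?_
  have h1 : ∀ (s : DualGroupAlg k G ⊗[k] (D.Arrow → k)), evalL g
      ((LinearMap.mul' k (DualGroupAlg k G) ∘ₗ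
      (HopfAlgebra.antipode k).lTensor (DualGroupAlg k G)).rTensor (D.Arrow → k)
      ((TensorProduct.assoc k _ _ _).symm ((TensorProduct.comm k (D.Arrow → k)
        (DualGroupAlg k G)).toLinearMap.lTensor (DualGroupAlg k G)
        (F.deltaR.lTensor (DualGroupAlg k G) s)))) = transpose (F.rAct g⁻¹) (evalL g s) := by
    intro s
    induction s with
    | zero => simp
    | add x y hx hy => simp only [map_add, hx, hy]
    | tmul x y =>
      simp only [deltaR, LinearMap.lTensor_tmul, LinearMap.sum_apply, LinearMap.comp_apply,
        LinearMap.flip_apply, TensorProduct.mk_apply, TensorProduct.tmul_sum, map_sum,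
        LinearEquiv.coe_coe, TensorProduct.comm_tmul, TensorProduct.assoc_symm_tmul,
        LinearMap.rTensor_tmul, LinearMap.mul'_apply, evalL_tmul, mul_apply, antipode_apply,
        p_apply, mul_ite, mul_one, mul_zero, ite_smul, zero_smul, sum_ite_p, map_smul]
  have h2 : evalL g (F.deltaL f) = transpose (F.lAct g) f := evalL_coactOf _ g f
  rw [evalL_coactOf, deltaCoad]
  simp only [LinearMap.comp_apply, LinearEquiv.coe_coe]
  have h3 := h1 (F.deltaL f)
  simp only [LinearMap.rTensor_comp, LinearMap.comp_apply] at h3 ⊢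
  rw [h3, h2, coadOp, transpose_comp, LinearMap.comp_apply]

theorem coadOp_one : F.coadOp 1 = LinearMap.id := by
  rw [coadOp, inv_one, lAct_one, rAct_one, LinearMap.comp_id, transpose_id]

theorem coadOp_mul (g h : G) : F.coadOp (g * h) = F.coadOp h ∘ₗ F.coadOp g := by
  rw [coadOp, coadOp, coadOp, ← transpose_comp, mul_inv_rev, lAct_mul, rAct_mul]
  congr 1
  refine LinearMap.ext fun x => ?_
  exact congrArg (F.lAct g) (LinearMap.congr_fun (F.lAct_rAct h g⁻¹) (F.rAct h⁻¹ x))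

theorem coadOp_apply (g : G) (f : D.Arrow → k) (a : D.Arrow) :
    F.coadOp g f a = ((F.basis a.cls a.i).repr
      (D.ρ a.cls a.i (op (F.ζ a.cls (a.src⁻¹ * a.tgt) a.cls_eq g⁻¹)) (F.basis a.cls a.i a.j))).sum
        fun s c => c * f ((a.rmul g⁻¹ s).lmul g) := by
  change Finsupp.linearCombination k f (F.lAct g (F.rAct g⁻¹ (Finsupp.single a 1))) = _
  rw [rAct, Finsupp.linearCombination_single, one_smul, lAct, Finsupp.lmapDomain_apply,
    ← Finsupp.mapDomain_comp, Finsupp.linearCombination_mapDomain,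
    Finsupp.linearCombination_apply]
  rfl

theorem coadOp_deg (g : G) (f : DualGroupAlg k G) (v : D.Arrow → k) (a : D.Arrow) :
    F.coadOp g (degAct Arrow.tgt f v) a = f (g * a.tgt * g⁻¹) * F.coadOp g v a := by
  rw [coadOp_apply, coadOp_apply, Finsupp.mul_sum]
  refine Finsupp.sum_congr fun s _ => ?_
  have h : ((a.rmul g⁻¹ s).lmul g).tgt = g * a.tgt * g⁻¹ := (mul_assoc _ _ _).symm
  rw [degAct_apply, mul_left_comm, h]

theorem coadOp_support (g : G) (v : D.Arrow → k) (hv : ∀ b, b.src ≠ 1 → v b = 0) (a : D.Arrow)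
    (ha : a.src ≠ 1) : F.coadOp g v a = 0 := by
  rw [coadOp_apply]
  refine Finset.sum_eq_zero fun s _ => ?_
  refine mul_eq_zero_of_right _ (hv _ ?_)
  have h : ((a.rmul g⁻¹ s).lmul g).src = g * a.src * g⁻¹ := (mul_assoc _ _ _).symm
  rw [h]
  simpa [mul_inv_eq_one] using ha

/-- The Yetter–Drinfeld `(kG)^*`-module `kQ_1^a`, with the left arrow action
`p_g · a = δ_{g, t(a)} a` and the adjoint coaction. -/
def coadFull : YetterDrinfeld k (DualGroupAlg k G) (D.Arrow → k) :=
  ydOf Arrow.tgt F.coadOp F.coadOp_one F.coadOp_mul F.coadOp_deg F.deltaCoad F.deltaCoad_eq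

/-- The inclusion in `kQ_1^a` of the subspace `kQ_1^{1a}` spanned by `Q_1^1`. -/
def inc1 (D : RSR k G) : (D.Arrow1 → k) →ₗ[k] (D.Arrow → k) :=
  Function.ExtendByZero.linearMap k Subtype.val

/-- The projection of `kQ_1^a` to the subspace `kQ_1^{1a}`. -/
def proj1 (D : RSR k G) : (D.Arrow → k) →ₗ[k] (D.Arrow1 → k) :=
  LinearMap.funLeft k k Subtype.val

theorem inc1_apply (v : D.Arrow1 → k) (a : D.Arrow1) : inc1 D v a.1 = v a :=
  Subtype.val_injective.extend_apply v 0 a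

theorem inc1_apply_of_ne (v : D.Arrow1 → k) (a : D.Arrow) (ha : a.src ≠ 1) : inc1 D v a = 0 :=
  Function.extend_apply' _ _ _ (by rintro ⟨b, rfl⟩; exact ha b.2)

theorem inc1_proj1 (v : D.Arrow → k) (hv : ∀ b, b.src ≠ 1 → v b = 0) :
    inc1 D (proj1 D v) = v := by
  funext a
  by_cases ha : a.src = 1
  · exact inc1_apply _ ⟨a, ha⟩
  · rw [inc1_apply_of_ne _ _ ha, hv a ha]

theorem proj1_inc1 (v : D.Arrow1 → k) : proj1 D (inc1 D v) = v := funext fun a => inc1_apply v a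

/-- The coaction on `kQ_1^{1a}`: the restriction of the adjoint coaction, see
`inc1_delta1`. -/
def delta1 : (D.Arrow1 → k) →ₗ[k] DualGroupAlg k G ⊗[k] (D.Arrow1 → k) :=
  (proj1 D).lTensor (DualGroupAlg k G) ∘ₗ F.deltaCoad ∘ₗ inc1 D

theorem inc1_coadOp (g : G) (v : D.Arrow1 → k) :
    inc1 D (proj1 D (F.coadOp g (inc1 D v))) = F.coadOp g (inc1 D v) :=
  inc1_proj1 _ (F.coadOp_support g _ fun b hb => inc1_apply_of_ne v b hb)

/-- The subspace `kQ_1^{1a}` is a subcomodule of `kQ_1^a` with coaction `delta1`. -/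
theorem inc1_delta1 : (inc1 D).lTensor (DualGroupAlg k G) ∘ₗ F.delta1 = F.deltaCoad ∘ₗ inc1 D := by
  refine LinearMap.ext fun v => ext_evalL fun g => ?_
  simp only [delta1, LinearMap.comp_apply, evalL_lTensor, deltaCoad_eq, evalL_coactOf, inc1_coadOp]

/-- The Yetter–Drinfeld `(kG)^*`-module `(kQ_1^{1a}, coad(G, r, ρ, u))`: the left arrow action
and the adjoint coaction of `kQ_1^a`, restricted to the span of the arrows which start at `1`. -/
def coad : YetterDrinfeld k (DualGroupAlg k G) (D.Arrow1 → k) :=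
  ydOf (fun a => a.1.tgt) (fun g => proj1 D ∘ₗ F.coadOp g ∘ₗ inc1 D)
    (by
      refine LinearMap.ext fun v => ?_
      simp [coadOp_one, proj1_inc1])
    (fun g h => by
      refine LinearMap.ext fun v => ?_
      simp only [LinearMap.comp_apply, inc1_coadOp, coadOp_mul])
    (fun g f v a => by
      have : inc1 D (degAct (fun a : D.Arrow1 => a.1.tgt) f v) = degAct Arrow.tgt f (inc1 D v) := by
        funext b
        by_cases hb : b.src = 1
        · exact (inc1_apply _ ⟨b, hb⟩).trans
            (congrArg (f b.tgt * ·) (inc1_apply v ⟨b, hb⟩)).symm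
        · rw [inc1_apply_of_ne _ _ hb, degAct_apply, inc1_apply_of_ne _ _ hb, mul_zero]
      rw [LinearMap.comp_apply, LinearMap.comp_apply, this]
      exact F.coadOp_deg g f (inc1 D v) a.1)
    F.delta1
    (by
      refine LinearMap.ext fun v => ext_evalL fun g => ?_
      simp only [delta1, LinearMap.comp_apply, evalL_lTensor, deltaCoad_eq, evalL_coactOf])

end RSR.Frame

end

end QuiverHopf

/-! The equivalence of (ii) and (iii) is functoriality of the Nichols algebra together with the fact
that the module sits in it as the component of degree one. A pull-push isomorphism extends to the
tensor algebras and respects all structure there, so it carries the largest admissible ideal to the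
largest admissible ideal (`PullPushIso.nichols`). Conversely that ideal has no part in degree one,
so an isomorphism of Nichols algebras restricts to the generating modules
(`NicholsPullPushIso.pullPushIso`).

For (i) and (ii), a Hopf isomorphism of the dual group algebras comes from a group isomorphism,
because the algebra maps from the dual of `kG` to `k` are the evaluations at elements of `G`
(`exists_eq_congr`). A Yetter–Drinfeld module over the dual of `kG` is a `G`-graded space with a
right action of `G` that conjugates degrees. For the span of the arrows from `1`, the component of
degree `u(C)` is the product over `i` of the dual spaces of the `X_C^{(i)}`, on which an element
`z⁻¹` of the centralizer acts as the transpose of `ρ(z)`.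

From (i) to (ii): the module is identified with families of functions `f` on `G`, with values in
these dual spaces, such that `f(zg) = f(g) ∘ ρ(z)` (`Frame.inducedEquiv`). The action multiplies by
a function of `g⁻¹ u(C) g` and the coaction is right translation. Neither bases nor coset
representatives occur in this model, so an isomorphism of RSR's acts on it by the substitution `g ↦
φ(h_C⁻¹ g)`.

From (ii) to (i): the isomorphism, composed with the operator of a suitable `h_C`, maps the
component of degree `u(C)` onto that of degree `u'(φ(C))`, equivariantly for the centralizers. Both
components are finite products of duals of irreducible representations. By Schur's lemma blocks
between non-isomorphic factors vanish, and counting dimensions for each isomorphism type matches the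
multiplicities (`exists_equiv_of_dual_equiv`). -/

namespace QuiverHopf

noncomputable section

/-! ### Functoriality of the Nichols algebra. -/

namespace YetterDrinfeld

variable {k H V : Type*} [Field k] [Ring H] [HopfAlgebra k H] [AddCommGroup V] [Module k V]
variable {H' V' : Type*} [Ring H'] [HopfAlgebra k H'] [AddCommGroup V'] [Module k V']

/-- The isomorphism of tensor algebras induced by a linear isomorphism. -/
def tensorEquiv (ψ : V ≃ₗ[k] V') : TensorAlgebra k V ≃ₐ[k] TensorAlgebra k V' :=
  AlgEquiv.ofAlgHom (TensorAlgebra.lift k (TensorAlgebra.ι k ∘ₗ ψ.toLinearMap))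
    (TensorAlgebra.lift k (TensorAlgebra.ι k ∘ₗ ψ.symm.toLinearMap))
    (by ext; simp) (by ext; simp)

@[simp] theorem tensorEquiv_ι (ψ : V ≃ₗ[k] V') (v : V) :
    tensorEquiv ψ (TensorAlgebra.ι k v) = TensorAlgebra.ι k (ψ v) := by
  simp [tensorEquiv]

theorem map_tensorEquiv_tensorGrade (ψ : V ≃ₗ[k] V') (n : ℕ) :
    (tensorGrade k V n).map (tensorEquiv ψ).toLinearMap = tensorGrade k V' n := by
  have h : (LinearMap.range (TensorAlgebra.ι k : V →ₗ[k] _)).map (tensorEquiv ψ).toAlgHom.toLinearMap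
      = LinearMap.range (TensorAlgebra.ι k : V' →ₗ[k] _) := by
    rw [← LinearMap.range_comp]
    have : (tensorEquiv ψ).toAlgHom.toLinearMap ∘ₗ TensorAlgebra.ι k =
        TensorAlgebra.ι k ∘ₗ ψ.toLinearMap := by
      ext v
      simp
    rw [this, LinearMap.range_comp_of_range_eq_top _ ψ.range]
  rw [tensorGrade, tensorGrade, ← h, ← Submodule.map_pow]
  rfl

theorem tensorEquiv_mem_tensorGrade (ψ : V ≃ₗ[k] V') {n : ℕ} {x : TensorAlgebra k V}
    (hx : x ∈ tensorGrade k V n) : tensorEquiv ψ x ∈ tensorGrade k V' n := by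
  rw [← map_tensorEquiv_tensorGrade ψ n]
  exact Submodule.mem_map_of_mem hx

theorem tensorEquiv_proj (ψ : V ≃ₗ[k] V') (n : ℕ) (x : TensorAlgebra k V) :
    tensorEquiv ψ (GradedRing.proj (tensorGrade k V) n x) =
      GradedRing.proj (tensorGrade k V') n (tensorEquiv ψ x) := by
  induction x using DirectSum.Decomposition.inductionOn (tensorGrade k V) with
  | zero => simp
  | add x y hx hy => simp only [map_add, hx, hy]
  | @homogeneous i m =>
    rw [GradedRing.proj_apply, GradedRing.proj_apply]
    have hm := tensorEquiv_mem_tensorGrade ψ m.2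
    rcases eq_or_ne i n with rfl | h
    · rw [DirectSum.decompose_of_mem_same _ m.2, DirectSum.decompose_of_mem_same _ hm]
    · rw [DirectSum.decompose_of_mem_ne _ m.2 h, DirectSum.decompose_of_mem_ne _ hm h, map_zero]

theorem nicholsAct_mk (Y : YetterDrinfeld k H V) (h : H) (x : TensorAlgebra k V) :
    Y.nicholsAct h (Y.nicholsMk x) = Y.nicholsMk (Y.tensorAct h x) := rfl

theorem nicholsCoact_mk (Y : YetterDrinfeld k H V) (x : TensorAlgebra k V) :
    Y.nicholsCoact (Y.nicholsMk x) = Y.nicholsMk.toLinearMap.lTensor H (Y.tensorCoact x) := rfl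

theorem nicholsComul_mk (Y : YetterDrinfeld k H V) (x : TensorAlgebra k V) :
    Y.nicholsComul (Y.nicholsMk x) =
      TensorProduct.map Y.nicholsMk.toLinearMap Y.nicholsMk.toLinearMap (Y.tensorComul x) := rfl

namespace PullPushIso

variable {Y : YetterDrinfeld k H V} {Y' : YetterDrinfeld k H' V'} {φ : H ≃ₐc[k] H'}

/-- The inverse of a pull-push isomorphism. -/
def symm (e : PullPushIso Y Y' φ) : PullPushIso Y' Y φ.symm where
  ψ := e.ψ.symm
  map_act h v := by
    rw [LinearEquiv.symm_apply_eq, e.map_act]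
    simp
  map_coact v := by
    obtain ⟨w, rfl⟩ := e.ψ.surjective v
    rw [← e.map_coact, LinearEquiv.symm_apply_apply, ← LinearMap.comp_apply,
      ← TensorProduct.map_comp]
    have h1 : (φ.symm : H' →ₗ[k] H) ∘ₗ (φ : H →ₗ[k] H') = LinearMap.id := by
      ext x
      simp
    have h2 : e.ψ.symm.toLinearMap ∘ₗ e.ψ.toLinearMap = LinearMap.id := by
      ext x
      simp
    rw [h1, h2, TensorProduct.map_id, LinearMap.id_apply]

theorem map_comul (φ : H ≃ₐc[k] H') (h : H) : TensorProduct.map (φ : H →ₗ[k] H')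
    (φ : H →ₗ[k] H') (Coalgebra.comul (R := k) h) = Coalgebra.comul (R := k) (φ h) :=
  CoalgHomClass.map_comp_comul_apply φ h

theorem tensorEquiv_tensorAct (e : PullPushIso Y Y' φ) (h : H) (x : TensorAlgebra k V) :
    tensorEquiv e.ψ (Y.tensorAct h x) = Y'.tensorAct (φ h) (tensorEquiv e.ψ x) := by
  -- On a product, `h` acts through the components of `Δ(h)`, so the induction hypotheses are needed
  -- for all elements of `H`.
  induction x using TensorAlgebra.induction generalizing h with
  | algebraMap r =>
    have h1 : Coalgebra.counit (R := k) (φ h) = Coalgebra.counit (R := k) h :=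
      CoalgHomClass.counit_comp_apply φ h
    simp only [Algebra.algebraMap_eq_smul_one, map_smul, tensorAct_one, map_one, h1]
  | ι v => simp only [tensorAct_ι, tensorEquiv_ι, e.map_act]
  | add x y hx hy => simp only [map_add, hx, hy]
  | mul x y hx hy =>
    rw [map_mul (tensorEquiv e.ψ) x y, tensorAct_mul, tensorAct_mul, ← map_comul]
    induction Coalgebra.comul (R := k) h with
    | zero => simp
    | add s t hs ht => simp only [map_add, hs, ht]
    | tmul a b =>
      simp only [TensorProduct.map_tmul, LinearMap.flip_apply, LinearMap.mul'_apply, map_mul,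
        hx, hy]
      rfl

/-- Both sides are algebra maps in `x`, so they only have to be compared on `V`. -/
theorem map_tensorCoact (e : PullPushIso Y Y' φ) (x : TensorAlgebra k V) :
    TensorProduct.map (φ : H →ₗ[k] H') (tensorEquiv e.ψ).toLinearMap (Y.tensorCoact x) =
      Y'.tensorCoact (tensorEquiv e.ψ x) := by
  have : (Algebra.TensorProduct.map ((φ : H ≃ₐ[k] H') : H →ₐ[k] H')
      ((tensorEquiv e.ψ : TensorAlgebra k V →ₐ[k] TensorAlgebra k V'))).comp Y.tensorCoact =
      Y'.tensorCoact.comp (tensorEquiv e.ψ : TensorAlgebra k V →ₐ[k] TensorAlgebra k V') := by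
    refine TensorAlgebra.hom_ext (LinearMap.ext fun v => ?_)
    change Algebra.TensorProduct.map _ _ (Y.tensorCoact (TensorAlgebra.ι k v)) =
      Y'.tensorCoact (tensorEquiv e.ψ (TensorAlgebra.ι k v))
    rw [tensorEquiv_ι, tensorCoact, tensorCoact, TensorAlgebra.lift_ι_apply,
      TensorAlgebra.lift_ι_apply, LinearMap.comp_apply, LinearMap.comp_apply, ← e.map_coact]
    induction Y.coact v with
    | zero => simp
    | add s t hs ht => simp only [map_add, hs, ht]
    | tmul a b => simp
  exact AlgHom.congr_fun this x

theorem map_primMul (e : PullPushIso Y Y' φ) (v : V)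
    (t : TensorAlgebra k V ⊗[k] TensorAlgebra k V) :
    TensorProduct.map (tensorEquiv e.ψ).toLinearMap (tensorEquiv e.ψ).toLinearMap
        (Y.primMul v t) =
      Y'.primMul (e.ψ v)
        (TensorProduct.map (tensorEquiv e.ψ).toLinearMap (tensorEquiv e.ψ).toLinearMap t) := by
  induction t with
  | zero => simp
  | add s t hs ht => simp only [map_add, hs, ht]
  | tmul c d =>
    rw [TensorProduct.map_tmul, primMul_tmul, primMul_tmul, map_add, TensorProduct.map_tmul,
      ← e.map_coact]
    congr 1
    · simp
    · induction Y.coact v with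
      | zero => simp
      | add s t hs ht => simp only [map_add, hs, ht]
      | tmul a b =>
        simp only [TensorProduct.map_tmul, LinearMap.flip_apply, LinearMap.comp_apply,
          LinearMap.mulRight_apply, AlgEquiv.toLinearMap_apply, map_mul, tensorEquiv_ι,
          e.tensorEquiv_tensorAct]
        rfl

theorem map_tensorComul (e : PullPushIso Y Y' φ) (x : TensorAlgebra k V) :
    TensorProduct.map (tensorEquiv e.ψ).toLinearMap (tensorEquiv e.ψ).toLinearMap
      (Y.tensorComul x) = Y'.tensorComul (tensorEquiv e.ψ x) := by
  -- The comultiplication is an algebra map into endomorphisms evaluated at `1 ⊗ 1`.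
  -- Multiplicativity is available only before that evaluation, so the claim is proved for every
  -- `t`.
  have : ∀ t, TensorProduct.map (tensorEquiv e.ψ).toLinearMap (tensorEquiv e.ψ).toLinearMap
      (TensorAlgebra.lift k Y.primMul x t) = TensorAlgebra.lift k Y'.primMul (tensorEquiv e.ψ x)
      (TensorProduct.map (tensorEquiv e.ψ).toLinearMap (tensorEquiv e.ψ).toLinearMap t) := by
    induction x using TensorAlgebra.induction with
    | algebraMap r => simp [Algebra.algebraMap_eq_smul_one]
    | ι v =>
      intro t
      simp only [TensorAlgebra.lift_ι_apply, tensorEquiv_ι, e.map_primMul]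
    | add x y hx hy => intro t; simp only [map_add, LinearMap.add_apply, hx, hy]
    | mul x y hx hy => intro t; simp only [map_mul, Module.End.mul_apply, hx, hy]
  have h := this (1 ⊗ₜ 1)
  simp only [TensorProduct.map_tmul, AlgEquiv.toLinearMap_apply, map_one] at h
  exact h

theorem map_range_rTensor_le {A B : Type*} [AddCommGroup A] [Module k A] [AddCommGroup B]
    [Module k B] (f : A →ₗ[k] B) (g : TensorAlgebra k V →ₗ[k] TensorAlgebra k V')
    {J : Ideal (TensorAlgebra k V)} {J' : Ideal (TensorAlgebra k V')} (h : ∀ x ∈ J, g x ∈ J') :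
    (LinearMap.range ((incl J).rTensor A)).map (TensorProduct.map g f) ≤
      LinearMap.range ((incl J').rTensor B) := by
  rw [← LinearMap.range_comp]
  have : TensorProduct.map g f ∘ₗ (incl J).rTensor A = (incl J').rTensor B ∘ₗ
      TensorProduct.map (g.restrict (p := J.restrictScalars k) (q := J'.restrictScalars k) h) f :=
    TensorProduct.ext' fun _ _ => rfl
  rw [this]
  exact LinearMap.range_comp_le_range _ _

theorem map_range_lTensor_le {A B : Type*} [AddCommGroup A] [Module k A] [AddCommGroup B]
    [Module k B] (f : A →ₗ[k] B) (g : TensorAlgebra k V →ₗ[k] TensorAlgebra k V')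
    {J : Ideal (TensorAlgebra k V)} {J' : Ideal (TensorAlgebra k V')} (h : ∀ x ∈ J, g x ∈ J') :
    (LinearMap.range ((incl J).lTensor A)).map (TensorProduct.map f g) ≤
      LinearMap.range ((incl J').lTensor B) := by
  rw [← LinearMap.range_comp]
  have : TensorProduct.map f g ∘ₗ (incl J).lTensor A = (incl J').lTensor B ∘ₗ
      TensorProduct.map f
        (g.restrict (p := J.restrictScalars k) (q := J'.restrictScalars k) h) :=
    TensorProduct.ext' fun _ _ => rfl
  rw [this]
  exact LinearMap.range_comp_le_range _ _

/-- Each defining condition involves only structure that `tensorEquiv` transports. The image of `J`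
is written as a preimage under the inverse; `key` and `mem` express that it is the image. -/
theorem isNicholsIdeal_comap (e : PullPushIso Y Y' φ) {J : Ideal (TensorAlgebra k V)}
    (hJ : Y.IsNicholsIdeal J) : Y'.IsNicholsIdeal (J.comap (tensorEquiv e.ψ).symm) := by
  have key : ∀ x' ∈ J.comap (tensorEquiv e.ψ).symm, ∃ x ∈ J, tensorEquiv e.ψ x = x' :=
    fun x' hx' => ⟨_, hx', AlgEquiv.apply_symm_apply _ _⟩
  have mem : ∀ x ∈ J, tensorEquiv e.ψ x ∈ J.comap (tensorEquiv e.ψ).symm := by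
    intro x hx
    rw [Ideal.mem_comap, AlgEquiv.symm_apply_apply]
    exact hx
  refine ⟨⟨fun {a} b ha => ?_⟩, fun i x' hx' => ?_, ?_, ?_, ?_, ?_, ?_⟩
  · rw [Ideal.mem_comap, map_mul]
    exact hJ.twoSided.mul_mem_of_left _ ha
  · obtain ⟨x, hx, rfl⟩ := key x' hx'
    have := mem _ (hJ.homogeneous i hx)
    rw [← GradedRing.proj_apply, tensorEquiv_proj] at this
    exact this
  · intro x' hx'
    obtain ⟨x, hx, rfl⟩ := key x' hx'
    rw [← tensorEquiv_proj, hJ.degree_zero x hx, map_zero]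
  · intro x' hx'
    obtain ⟨x, hx, rfl⟩ := key x' hx'
    rw [← tensorEquiv_proj, hJ.degree_one x hx, map_zero]
  · intro x' hx'
    obtain ⟨x, hx, rfl⟩ := key x' hx'
    rw [← e.map_tensorComul]
    have h := Submodule.mem_map_of_mem (f := TensorProduct.map (tensorEquiv e.ψ).toLinearMap
      (tensorEquiv e.ψ).toLinearMap) (hJ.comul_mem x hx)
    rw [Submodule.map_sup] at h
    have h1 := map_range_rTensor_le (tensorEquiv e.ψ).toLinearMap (tensorEquiv e.ψ).toLinearMap mem
    have h2 := map_range_lTensor_le (tensorEquiv e.ψ).toLinearMap (tensorEquiv e.ψ).toLinearMap mem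
    exact sup_le_sup h1 h2 h
  · intro h' x' hx'
    obtain ⟨x, hx, rfl⟩ := key x' hx'
    -- Stability is required under all of `H'`, whence the surjectivity of `φ`.
    obtain ⟨h, rfl⟩ : ∃ h, φ h = h' := φ.surjective h'
    rw [← e.tensorEquiv_tensorAct]
    exact mem _ (hJ.act_mem h x hx)
  · intro x' hx'
    obtain ⟨x, hx, rfl⟩ := key x' hx'
    rw [← e.map_tensorCoact]
    exact map_range_lTensor_le _ _ mem (Submodule.mem_map_of_mem (hJ.coact_mem x hx))

/-- The image of the largest ideal is admissible, hence contained in the largest ideal of the other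
side. Applied also to `e.symm`, this makes the induced map of quotients invertible. -/
theorem tensorEquiv_mem_nicholsIdeal (e : PullPushIso Y Y' φ) {x : TensorAlgebra k V}
    (hx : x ∈ Y.nicholsIdeal) : tensorEquiv e.ψ x ∈ Y'.nicholsIdeal :=
  Y'.le_nicholsIdeal (e.isNicholsIdeal_comap Y.isNicholsIdeal_nicholsIdeal) (by
    rw [Ideal.mem_comap, AlgEquiv.symm_apply_apply]
    exact hx)

/-- The homomorphism of Nichols algebras induced by a pull-push isomorphism. -/
def nicholsHom (e : PullPushIso Y Y' φ) : Y.Nichols →ₐ[k] Y'.Nichols :=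
  Ideal.Quotient.liftₐ Y.nicholsIdeal (Y'.nicholsMk.comp (tensorEquiv e.ψ).toAlgHom)
    fun _ hx => Y'.nicholsMk_eq_zero (e.tensorEquiv_mem_nicholsIdeal hx)

theorem nicholsMk_surjective (Y : YetterDrinfeld k H V) : Function.Surjective Y.nicholsMk :=
  Ideal.Quotient.mk_surjective

/-- The isomorphism of Nichols algebras induced by a pull-push isomorphism. -/
def nicholsEquiv (e : PullPushIso Y Y' φ) : Y.Nichols ≃ₐ[k] Y'.Nichols :=
  AlgEquiv.ofAlgHom e.nicholsHom e.symm.nicholsHom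
    (AlgHom.ext fun x => by
      obtain ⟨x, rfl⟩ := nicholsMk_surjective Y' x
      exact congrArg Y'.nicholsMk ((tensorEquiv e.ψ).apply_symm_apply x))
    (AlgHom.ext fun x => by
      obtain ⟨x, rfl⟩ := nicholsMk_surjective Y x
      exact congrArg Y.nicholsMk ((tensorEquiv e.ψ).symm_apply_apply x))

theorem nicholsEquiv_mk (e : PullPushIso Y Y' φ) (x : TensorAlgebra k V) :
    e.nicholsEquiv (Y.nicholsMk x) = Y'.nicholsMk (tensorEquiv e.ψ x) := rfl

/-- Functoriality of the Nichols algebra. -/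
def nichols (e : PullPushIso Y Y' φ) : NicholsPullPushIso Y Y' φ where
  ψ := e.nicholsEquiv
  map_grade n := by
    rw [nicholsGrade, nicholsGrade, ← map_tensorEquiv_tensorGrade e.ψ, ← Submodule.map_comp,
      ← Submodule.map_comp]
    rfl
  map_comul x := by
    obtain ⟨x, rfl⟩ := nicholsMk_surjective Y x
    rw [nicholsEquiv_mk, nicholsComul_mk, nicholsComul_mk, ← e.map_tensorComul,
      TensorProduct.map_map, TensorProduct.map_map]
    rfl
  map_counit x := by
    obtain ⟨x, rfl⟩ := nicholsMk_surjective Y x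
    rw [nicholsEquiv_mk, nicholsCounit, nicholsCounit, descend_mk, descend_mk]
    have : (TensorAlgebra.algebraMapInv (R := k) (M := V')).comp (tensorEquiv e.ψ).toAlgHom =
        TensorAlgebra.algebraMapInv := by
      ext v
      simp [TensorAlgebra.algebraMapInv]
    exact AlgHom.congr_fun this x
  map_act h x := by
    obtain ⟨x, rfl⟩ := nicholsMk_surjective Y x
    rw [nicholsEquiv_mk, nicholsAct_mk, nicholsAct_mk, ← e.tensorEquiv_tensorAct]
    rfl
  map_coact x := by
    obtain ⟨x, rfl⟩ := nicholsMk_surjective Y x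
    rw [nicholsEquiv_mk, nicholsCoact_mk, nicholsCoact_mk, ← e.map_tensorCoact, LinearMap.lTensor,
      LinearMap.lTensor, TensorProduct.map_map, TensorProduct.map_map]
    rfl

end PullPushIso

/-! ### Recovery of the Yetter–Drinfeld module from degree one. -/

/-- The map `V → 𝓑(V)`. -/
def nicholsι (Y : YetterDrinfeld k H V) : V →ₗ[k] Y.Nichols :=
  Y.nicholsMk.toLinearMap ∘ₗ TensorAlgebra.ι k

theorem nicholsι_apply (Y : YetterDrinfeld k H V) (v : V) :
    Y.nicholsι v = Y.nicholsMk (TensorAlgebra.ι k v) := rfl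

/-- The defining ideal has zero projection to degree one, whereas a vector of `V` is its own
projection. -/
theorem nicholsι_injective (Y : YetterDrinfeld k H V) : Function.Injective Y.nicholsι := by
  rw [← LinearMap.ker_eq_bot, LinearMap.ker_eq_bot']
  intro v hv
  have h1 := Y.isNicholsIdeal_nicholsIdeal.degree_one _ (Ideal.Quotient.eq_zero_iff_mem.1 hv)
  have h2 : TensorAlgebra.ι k v ∈ tensorGrade k V 1 := by
    rw [tensorGrade, pow_one]
    exact ⟨v, rfl⟩
  rw [GradedRing.proj_apply, DirectSum.decompose_of_mem_same _ h2] at h1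
  exact (TensorAlgebra.ι_eq_zero_iff k v).1 h1

theorem range_nicholsι (Y : YetterDrinfeld k H V) :
    LinearMap.range Y.nicholsι = Y.nicholsGrade 1 := by
  rw [nicholsι, LinearMap.range_comp, nicholsGrade, tensorGrade, pow_one]

theorem nicholsAct_nicholsι (Y : YetterDrinfeld k H V) (h : H) (v : V) :
    Y.nicholsAct h (Y.nicholsι v) = Y.nicholsι (Y.act h v) := by
  rw [nicholsι_apply, nicholsι_apply, nicholsAct_mk, tensorAct_ι]

theorem nicholsCoact_nicholsι (Y : YetterDrinfeld k H V) (v : V) :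
    Y.nicholsCoact (Y.nicholsι v) = Y.nicholsι.lTensor H (Y.coact v) := by
  rw [nicholsι_apply, nicholsCoact_mk, tensorCoact, TensorAlgebra.lift_ι_apply,
    LinearMap.comp_apply, ← LinearMap.lTensor_comp_apply]
  rfl

namespace NicholsPullPushIso

variable {Y : YetterDrinfeld k H V} {Y' : YetterDrinfeld k H' V'} {φ : H ≃ₐc[k] H'}

/-- The linear isomorphism of the components of degree one. -/
def degreeOne (e : NicholsPullPushIso Y Y' φ) : V ≃ₗ[k] V' :=
  (LinearEquiv.ofInjective Y.nicholsι Y.nicholsι_injective).trans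
    ((e.ψ.toLinearEquiv.submoduleMap (LinearMap.range Y.nicholsι)).trans
      ((LinearEquiv.ofEq _ _ (by
        rw [range_nicholsι, range_nicholsι]
        exact e.map_grade 1)).trans
        (LinearEquiv.ofInjective Y'.nicholsι Y'.nicholsι_injective).symm))

theorem nicholsι_degreeOne (e : NicholsPullPushIso Y Y' φ) (v : V) :
    Y'.nicholsι (e.degreeOne v) = e.ψ (Y.nicholsι v) := by
  rw [← LinearEquiv.ofInjective_apply (h := Y'.nicholsι_injective), degreeOne]
  simp only [LinearEquiv.trans_apply, LinearEquiv.apply_symm_apply]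
  rfl

/-- An isomorphism of Nichols algebras restricts to an isomorphism of Yetter–Drinfeld modules in
degree one. -/
def pullPushIso (e : NicholsPullPushIso Y Y' φ) : PullPushIso Y Y' φ where
  ψ := e.degreeOne
  map_act h v := Y'.nicholsι_injective (by
    rw [nicholsι_degreeOne, ← nicholsAct_nicholsι, ← nicholsAct_nicholsι, e.map_act,
      nicholsι_degreeOne])
  map_coact v := by
    -- Over a field `H'` is flat, so the identity in `H' ⊗ V'` may be checked in `H' ⊗ 𝓑(V')`.
    refine Module.Flat.lTensor_preserves_injective_linearMap (M := H') _ Y'.nicholsι_injective ?_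
    rw [← nicholsCoact_nicholsι, nicholsι_degreeOne, ← e.map_coact, nicholsCoact_nicholsι]
    simp only [LinearMap.lTensor]
    rw [TensorProduct.map_map, TensorProduct.map_map]
    congr 2
    ext v
    exact e.nicholsι_degreeOne v

end NicholsPullPushIso

end YetterDrinfeld

/-! ### Isomorphisms of duals of group algebras -/

namespace DualGroupAlg

variable {k G G' : Type*} [Field k] [Group G] [Fintype G] [Group G'] [Fintype G']

/-- The isomorphism of Hopf algebras `(kG)^* → (kG')^*` dual to an isomorphism of groups. -/
def congr (α : G ≃* G') : DualGroupAlg k G ≃ₐc[k] DualGroupAlg k G' :=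
  BialgEquiv.ofAlgEquiv
    { toFun := fun f g' => f (α.symm g')
      invFun := fun f' g => f' (α g)
      left_inv := fun f => by ext g; simp
      right_inv := fun f' => by ext g'; simp
      map_mul' := fun _ _ => rfl
      map_add' := fun _ _ => rfl
      commutes' := fun _ => rfl }
    (by
      ext f
      change f (α.symm 1) = f 1
      rw [map_one])
    (by
      refine AlgHom.ext fun f => ext_evalL fun a => ext fun b => ?_
      have h : ∀ t : DualGroupAlg k G ⊗[k] DualGroupAlg k G, ∀ (χ : DualGroupAlg k G →ₐ[k]
          DualGroupAlg k G'), (∀ f g', χ f g' = f (α.symm g')) →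
          evalL a (Algebra.TensorProduct.map χ χ t) b = evalL (α.symm a) t (α.symm b) := by
        intro t χ hχ
        induction t with
        | zero => simp
        | add x y hx hy => simp only [map_add, add_apply, hx, hy]
        | tmul x y => simp [hχ]
      refine (h _ _ fun _ _ => rfl).trans ?_
      let f' : DualGroupAlg k G' := fun g' => f (α.symm g')
      have h1 : shift (α.symm a) f (α.symm b) = shift a f' b :=
        congrArg f (map_mul α.symm a b).symm
      rw [← evalL_comul, ← evalL_comul] at h1
      exact h1)

theorem congr_apply (α : G ≃* G') (f : DualGroupAlg k G) (g' : G') :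
    congr α f g' = f (α.symm g') := rfl

/-- The `p_g` sum to `1`, so `χ` is nonzero on some `p_g`; the relation `f p_g = f(g) p_g` then
determines `χ`. -/
theorem exists_algHom_eq_eval (χ : DualGroupAlg k G →ₐ[k] k) : ∃ g, ∀ f, χ f = f g := by
  have h1 : ∑ g : G, χ (p g) = 1 := by
    rw [← map_sum, ← map_one χ]
    congr 1
    rw [← sum_p (1 : DualGroupAlg k G)]
    simp
  obtain ⟨g, -, hg⟩ := Finset.exists_ne_zero_of_sum_ne_zero (h1.symm ▸ one_ne_zero)
  refine ⟨g, fun f => mul_right_cancel₀ hg ?_⟩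
  have : f * p g = f g • p g := by
    ext h
    by_cases hh : h = g
    · simp [hh]
    · simp [hh]
  rw [← map_mul, this, map_smul, smul_eq_mul]

/-- Together with `ext_evalL` this turns a comparison of coactions into a comparison of the
operators attached to single group elements. -/
theorem evalL_map {V V' : Type*} [AddCommGroup V] [Module k V] [AddCommGroup V'] [Module k V']
    (φ : DualGroupAlg k G →ₗ[k] DualGroupAlg k G') (ψ : V →ₗ[k] V') {g : G} {g' : G'}
    (h : ∀ f, φ f g' = f g) (t : DualGroupAlg k G ⊗[k] V) :
    evalL g' (TensorProduct.map φ ψ t) = ψ (evalL g t) := by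
  induction t with
  | zero => simp
  | add x y hx hy => simp only [map_add, hx, hy]
  | tmul x y => simp [h]

/-- Every isomorphism `(kG)^* → (kG')^*` is dual to an isomorphism of groups. -/
theorem exists_eq_congr (φ : DualGroupAlg k G ≃ₐc[k] DualGroupAlg k G') :
    ∃ α : G ≃* G', ∀ f g', φ f g' = f (α.symm g') := by
  have h1 : ∀ g' : G', ∃ g, ∀ f : DualGroupAlg k G, φ f g' = f g := fun g' =>
    exists_algHom_eq_eval ((eval g').comp ((φ : DualGroupAlg k G ≃ₐ[k] DualGroupAlg k G') :
      DualGroupAlg k G →ₐ[k] DualGroupAlg k G'))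
  have h2 : ∀ g : G, ∃ g', ∀ f : DualGroupAlg k G', φ.symm f g = f g' := fun g =>
    exists_algHom_eq_eval ((eval g).comp ((φ.symm : DualGroupAlg k G' ≃ₐ[k] DualGroupAlg k G) :
      DualGroupAlg k G' →ₐ[k] DualGroupAlg k G))
  choose θ hθ using h1
  choose η hη using h2
  have sep : ∀ {x y : G}, (∀ f : DualGroupAlg k G, f x = f y) → x = y := by
    intro x y h
    have := h (p y)
    by_contra hxy
    simp [hxy] at this
  have sep' : ∀ {x y : G'}, (∀ f : DualGroupAlg k G', f x = f y) → x = y := by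
    intro x y h
    have := h (p y)
    by_contra hxy
    simp [hxy] at this
  -- The product of the group is dual to `Δ`: evaluating the compatibility of `φ` with `Δ` at `a`
  -- and `b` gives multiplicativity.
  have hmul : ∀ a b, θ (a * b) = θ a * θ b := fun a b => sep fun f => by
    have h := congrArg (evalL a) (YetterDrinfeld.PullPushIso.map_comul φ f)
    rw [evalL_map (g := θ a) (φ : DualGroupAlg k G →ₗ[k] DualGroupAlg k G')
      (φ : DualGroupAlg k G →ₗ[k] DualGroupAlg k G') (fun f => hθ a f), evalL_comul, evalL_comul] at h
    have h' : φ (shift (θ a) f) b = shift a (φ f) b := congrArg (fun f : DualGroupAlg k G' => f b) h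
    exact (hθ (a * b) f).symm.trans (h'.symm.trans (hθ b _))
  refine ⟨MulEquiv.symm ⟨⟨θ, η, fun g' => sep' fun f => ?_, fun g => sep fun f => ?_⟩, hmul⟩,
    fun f g' => hθ g' f⟩
  · refine (hη (θ g') f).symm.trans ((hθ g' (φ.symm f)).symm.trans ?_)
    rw [BialgEquiv.apply_symm_apply]
  · refine (hθ (η g) f).symm.trans ((hη g (φ f)).symm.trans ?_)
    rw [BialgEquiv.symm_apply_apply]

end DualGroupAlg

/-! ### The coadjoint Yetter–Drinfeld module as an induced module -/

universe uk uG

namespace RSR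

open MulOpposite DualGroupAlg

variable {k : Type uk} {G : Type uG} [Field k] [Group G]

/-- Families of functions on `G` with values in the dual spaces of the representations, equivariant
with respect to the centralizers. -/
def inducedDual (D : RSR k G) :
    Submodule k ((q : Σ C, D.I C) → G → Module.Dual k (D.X q.1 q.2)) where
  carrier := {f | ∀ (q : Σ C, D.I C) (z : D.Z q.1) (g : G) (x : D.X q.1 q.2),
    f q (z * g) x = f q g (D.ρ q.1 q.2 (op z) x)}
  add_mem' hf hf' q z g x := by simp [hf q z g x, hf' q z g x]
  zero_mem' _ _ _ _ := rfl
  smul_mem' c f hf q z g x := by simp [hf q z g x]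

namespace Frame

variable {D : RSR k G} (F : D.Frame)

/-- The factor `1⁻¹` is the inverse of the source of an arrow from `1`. It is kept so that the
expressions match `Arrow.cls_eq` without transport. -/
theorem mk_one_inv_mul_u (D : RSR k G) (C : ConjClasses G) :
    ConjClasses.mk ((1 : G)⁻¹ * D.u C) = C := by
  rw [inv_one, one_mul, D.mk_u]

/-- The normalization of the representatives enters here: the coset of the centralizer itself is
represented by `1`, so the first factor of `ζ` disappears. -/
theorem coe_ζ_u (C : ConjClasses G) (hC : ConjClasses.mk ((1 : G)⁻¹ * D.u C) = C) (g : G) :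
    (F.ζ C ((1 : G)⁻¹ * D.u C) hC g : G) = g * (F.rep (g⁻¹ * D.u C * g))⁻¹ := by
  simp [ζ, F.rep_u]

theorem ζ_u_coe (C : ConjClasses G) (hC : ConjClasses.mk ((1 : G)⁻¹ * D.u C) = C) (z : D.Z C) :
    F.ζ C ((1 : G)⁻¹ * D.u C) hC z = z := by
  ext
  have : (z : G)⁻¹ * D.u C * z = D.u C := by
    rw [mul_assoc, ← mem_Z.1 z.2, inv_mul_cancel_left]
  rw [coe_ζ_u, this, F.rep_u, inv_one, mul_one]

theorem ζ_u_rep (C : ConjClasses G) (hC : ConjClasses.mk ((1 : G)⁻¹ * D.u C) = C) (d : G)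
    (hd : ConjClasses.mk d = C) : F.ζ C ((1 : G)⁻¹ * D.u C) hC (F.rep d) = 1 := by
  subst hd
  ext
  rw [coe_ζ_u, F.rep_spec, mul_inv_cancel, Subgroup.coe_one]

variable [Fintype G]

/-- The pairing of an element of `kQ_1^{1a}` with the arrows from `1` to `d`. -/
def pairing (v : D.Arrow1 → k) (d : G) (C : ConjClasses G)
    (hC : ConjClasses.mk ((1 : G)⁻¹ * d) = C) (i : D.I C) : Module.Dual k (D.X C i) :=
  Finsupp.linearCombination k (inc1 D v) ∘ₗ F.arrowVec 1 d C hC i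

theorem pairing_basis (v : D.Arrow1 → k) (a : D.Arrow1) (d : G) (C : ConjClasses G)
    (hC : ConjClasses.mk ((1 : G)⁻¹ * d) = C) (i : D.I C) (j : D.J C i)
    (ha : a.1 = ⟨1, d, C, hC, i, j⟩) : F.pairing v d C hC i (F.basis C i j) = v a := by
  rw [pairing, LinearMap.comp_apply, arrowVec_basis, Finsupp.linearCombination_single, one_smul,
    ← ha, inc1_apply]

theorem pairing_congr (v : D.Arrow1 → k) {d d' : G} {C : ConjClasses G}
    {hC : ConjClasses.mk ((1 : G)⁻¹ * d) = C} {hC' : ConjClasses.mk ((1 : G)⁻¹ * d') = C} {i : D.I C}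
    (hd : d = d') : F.pairing v d C hC i = F.pairing v d' C hC' i := by
  subst hd
  rfl

theorem ext_pairing {v w : D.Arrow1 → k}
    (h : ∀ d C hC i x, F.pairing v d C hC i x = F.pairing w d C hC i x) : v = w := by
  funext a
  obtain ⟨⟨s, d, C, hC, i, j⟩, ha⟩ := a
  obtain rfl : s = 1 := ha
  have := h d C hC i (F.basis C i j)
  rwa [F.pairing_basis v ⟨⟨1, d, C, hC, i, j⟩, rfl⟩ d C hC i j rfl,
    F.pairing_basis w ⟨⟨1, d, C, hC, i, j⟩, rfl⟩ d C hC i j rfl] at this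

/-- The right action of `G` on `kQ_1^{1a}` that corresponds to the coaction. -/
def coadOp1 (g : G) : Module.End k (D.Arrow1 → k) := proj1 D ∘ₗ F.coadOp g ∘ₗ inc1 D

/-- The operator is the transpose of `x ↦ g · x · g⁻¹`. The projection built into it loses nothing,
since conjugation preserves the source `1`. -/
theorem linearCombination_coadOp1 (g : G) (v : D.Arrow1 → k) (w : D.Arrow →₀ k) :
    Finsupp.linearCombination k (inc1 D (F.coadOp1 g v)) w =
      Finsupp.linearCombination k (inc1 D v) (F.lAct g (F.rAct g⁻¹ w)) := by
  rw [coadOp1, LinearMap.comp_apply, LinearMap.comp_apply, inc1_coadOp, coadOp,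
    transpose_pairing]
  rfl

theorem coadOp1_one : F.coadOp1 1 = LinearMap.id := by
  refine LinearMap.ext fun v => ?_
  simp [coadOp1, coadOp_one, proj1_inc1]

theorem coadOp1_mul (g h : G) (v : D.Arrow1 → k) :
    F.coadOp1 (g * h) v = F.coadOp1 h (F.coadOp1 g v) := by
  simp only [coadOp1, LinearMap.comp_apply, inc1_coadOp, coadOp_mul]

/-- The family of functions on `G` that corresponds to an element of `kQ_1^{1a}`. -/
def toInducedFun (v : D.Arrow1 → k) (q : Σ C, D.I C) (g : G) : Module.Dual k (D.X q.1 q.2) :=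
  F.pairing (F.coadOp1 g⁻¹ v) (D.u q.1) q.1 (mk_one_inv_mul_u D q.1) q.2

theorem mk_conj_u (C : ConjClasses G) (g : G) :
    ConjClasses.mk ((1 : G)⁻¹ * (g⁻¹ * D.u C * g)) = C := by
  rw [inv_one, one_mul, mk_conj, D.mk_u]

/-- By transposition the operator moves to the other argument as `x ↦ g⁻¹ · x · g`. This sends
arrows `1 → d` to combinations of arrows `1 → g⁻¹ d g`, with coefficients given by `ρ` at `ζ(g)`. -/
theorem pairing_coadOp1 (v : D.Arrow1 → k) (g d : G) (C : ConjClasses G)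
    (hC : ConjClasses.mk ((1 : G)⁻¹ * d) = C)
    (hC' : ConjClasses.mk ((1 : G)⁻¹ * (g⁻¹ * d * g)) = C) (i : D.I C) (x : D.X C i) :
    F.pairing (F.coadOp1 g⁻¹ v) d C hC i x =
      F.pairing v (g⁻¹ * d * g) C hC' i (D.ρ C i (op (F.ζ C ((1 : G)⁻¹ * d) hC g)) x) := by
  rw [pairing, pairing, LinearMap.comp_apply, LinearMap.comp_apply, linearCombination_coadOp1,
    inv_inv, rAct_arrowVec, lAct_arrowVec]
  congr 1
  exact F.arrowVec_congr (by simp) (by group) rfl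

theorem toInducedFun_apply (v : D.Arrow1 → k) (q : Σ C, D.I C) (g : G) (x : D.X q.1 q.2) :
    F.toInducedFun v q g x = F.pairing v (g⁻¹ * D.u q.1 * g) q.1 (mk_conj_u q.1 g) q.2
      (D.ρ q.1 q.2 (op (F.ζ q.1 ((1 : G)⁻¹ * D.u q.1) (mk_one_inv_mul_u D q.1) g)) x) :=
  F.pairing_coadOp1 v g _ _ _ _ _ x

theorem toInducedFun_coadOp1 (v : D.Arrow1 → k) (h : G) (q : Σ C, D.I C) (g : G) :
    F.toInducedFun (F.coadOp1 h v) q g = F.toInducedFun v q (g * h⁻¹) := by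
  rw [toInducedFun, toInducedFun, ← coadOp1_mul]
  congr 2
  group

/-- In degree `u(C)` the centralizer fixes the degree and `ζ(z) = z`, so the transpose of `ρ` itself
appears. Both the equivariance of the induced functions and the reconstruction of `ρ` rest on this.
-/
theorem pairing_coadOp1_inv_coe (v : D.Arrow1 → k) (C : ConjClasses G) (i : D.I C) (z : D.Z C)
    (hC : ConjClasses.mk ((1 : G)⁻¹ * D.u C) = C) (x : D.X C i) :
    F.pairing (F.coadOp1 (z : G)⁻¹ v) (D.u C) C hC i x =
      F.pairing v (D.u C) C hC i (D.ρ C i (op z) x) := by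
  rw [F.pairing_coadOp1 v z _ C hC (mk_conj_u C z), ζ_u_coe]
  have : (z : G)⁻¹ * D.u C * z = D.u C := by
    rw [mul_assoc, ← mem_Z.1 z.2, inv_mul_cancel_left]
  rw [F.pairing_congr v this]

theorem toInducedFun_mem (v : D.Arrow1 → k) : F.toInducedFun v ∈ D.inducedDual := by
  intro q z g x
  rw [toInducedFun, mul_inv_rev, coadOp1_mul, pairing_coadOp1_inv_coe]
  rfl

/-- At a coset representative the factor `ζ` is trivial, so the function returns the coordinates of
`v` at the arrows `1 → d`. This dictates the inverse map in `inducedEquiv`. -/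
theorem toInducedFun_rep (v : D.Arrow1 → k) (d : G) (C : ConjClasses G)
    (hC : ConjClasses.mk ((1 : G)⁻¹ * d) = C) (i : D.I C) :
    F.toInducedFun v ⟨C, i⟩ (F.rep d) = F.pairing v d C hC i := by
  have hd : ConjClasses.mk d = C := by rw [← hC, inv_one, one_mul]
  refine LinearMap.ext fun x => ?_
  rw [toInducedFun_apply, ζ_u_rep _ _ _ _ hd, op_one, map_one, Module.End.one_apply]
  have : (F.rep d)⁻¹ * D.u C * F.rep d = d := by
    rw [← hd]
    exact F.rep_spec d
  rw [F.pairing_congr v this]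

/-- The isomorphism of `kQ_1^{1a}` with the induced module. -/
def inducedEquiv : (D.Arrow1 → k) ≃ₗ[k] D.inducedDual where
  toFun v := ⟨F.toInducedFun v, F.toInducedFun_mem v⟩
  map_add' v w := by
    refine Subtype.ext (funext fun q => funext fun g => LinearMap.ext fun x => ?_)
    simp [toInducedFun, pairing, Finsupp.linearCombination_apply, Finsupp.sum, mul_add,
      Finset.sum_add_distrib]
  map_smul' c v := by
    refine Subtype.ext (funext fun q => funext fun g => LinearMap.ext fun x => ?_)
    simp [toInducedFun, pairing, Finsupp.linearCombination_apply, Finsupp.sum, mul_left_comm,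
      Finset.mul_sum]
  invFun f a := f.1 ⟨a.1.cls, a.1.i⟩ (F.rep a.1.tgt) (F.basis a.1.cls a.1.i a.1.j)
  left_inv v := by
    funext a
    obtain ⟨⟨s, d, C, hC, i, j⟩, ha⟩ := a
    obtain rfl : s = 1 := ha
    change F.toInducedFun v ⟨C, i⟩ (F.rep d) _ = _
    rw [F.toInducedFun_rep v d C hC, F.pairing_basis v ⟨⟨1, d, C, hC, i, j⟩, rfl⟩ d C hC i j rfl]
  right_inv f := by
    refine Subtype.ext (funext fun q => funext fun g => LinearMap.ext fun x => ?_)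
    have h : ∀ d C hC i, F.pairing (fun a : D.Arrow1 => f.1 ⟨a.1.cls, a.1.i⟩ (F.rep a.1.tgt)
        (F.basis a.1.cls a.1.i a.1.j)) d C hC i = f.1 ⟨C, i⟩ (F.rep d) := by
      intro d C hC i
      refine (F.basis C i).ext fun j => ?_
      rw [F.pairing_basis _ ⟨⟨1, d, C, hC, i, j⟩, rfl⟩ d C hC i j rfl]
    change F.toInducedFun _ q g x = f.1 q g x
    -- Since `ζ(g)` times the representative of the coset of `g` is `g`, equivariance carries the
    -- value at the representative to the value at `g`.
    rw [toInducedFun_apply, h, ← f.2]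
    congr 1
    rw [coe_ζ_u]
    simp

theorem inducedEquiv_apply (v : D.Arrow1 → k) (q : Σ C, D.I C) (g : G) :
    (F.inducedEquiv v).1 q g = F.toInducedFun v q g := rfl

theorem coad_act_apply (f : DualGroupAlg k G) (v : D.Arrow1 → k) (a : D.Arrow1) :
    F.coad.act f v a = f a.1.tgt * v a := rfl

theorem evalL_coad_coact (g : G) (v : D.Arrow1 → k) :
    evalL g (F.coad.coact v) = F.coadOp1 g v := by
  change evalL g (F.delta1 v) = _
  simp only [delta1, LinearMap.comp_apply, evalL_lTensor, deltaCoad_eq, evalL_coactOf, coadOp1]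

theorem pairing_act (f : DualGroupAlg k G) (v : D.Arrow1 → k) (d : G) (C : ConjClasses G)
    (hC : ConjClasses.mk ((1 : G)⁻¹ * d) = C) (i : D.I C) :
    F.pairing (F.coad.act f v) d C hC i = f d • F.pairing v d C hC i := by
  refine (F.basis C i).ext fun j => ?_
  rw [LinearMap.smul_apply, F.pairing_basis _ ⟨⟨1, d, C, hC, i, j⟩, rfl⟩ d C hC i j rfl,
    F.pairing_basis _ ⟨⟨1, d, C, hC, i, j⟩, rfl⟩ d C hC i j rfl, coad_act_apply, smul_eq_mul]

theorem toInducedFun_act (f : DualGroupAlg k G) (v : D.Arrow1 → k) (q : Σ C, D.I C) (g : G) :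
    F.toInducedFun (F.coad.act f v) q g = f (g⁻¹ * D.u q.1 * g) • F.toInducedFun v q g := by
  refine LinearMap.ext fun x => ?_
  rw [LinearMap.smul_apply, toInducedFun_apply, toInducedFun_apply, pairing_act]
  rfl

end Frame

/-! ### From isomorphisms of RSR's to isomorphisms of Yetter–Drinfeld modules -/

namespace Iso

variable {G' : Type*} [Group G'] {D : RSR k G} {D' : RSR k G'}

/-- The bijection of the index sets of all representations. -/
def indexEquiv (e : D.Iso D') : (Σ C, D.I C) ≃ Σ C', D'.I C' :=
  Equiv.sigmaCongr
    (Equiv.ofBijective (ConjClasses.map e.φ.toMonoidHom) (by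
      refine Function.bijective_iff_has_inverse.2 ⟨ConjClasses.map e.φ.symm.toMonoidHom, ?_, ?_⟩
      · intro C
        obtain ⟨g, rfl⟩ := ConjClasses.mk_surjective C
        exact congrArg ConjClasses.mk (e.φ.symm_apply_apply g)
      · intro C
        obtain ⟨g, rfl⟩ := ConjClasses.mk_surjective C
        exact congrArg ConjClasses.mk (e.φ.apply_symm_apply g)))
    fun C => e.e C

theorem indexEquiv_apply (e : D.Iso D') (q : Σ C, D.I C) :
    e.indexEquiv q = ⟨ConjClasses.map e.φ.toMonoidHom q.1, e.e q.1 q.2⟩ := rfl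

/-- The isomorphism of representations, as an isomorphism between members of the total families. -/
def repEquiv (e : D.Iso D') (q : Σ C, D.I C) :
    D.X q.1 q.2 ≃ₗ[k] D'.X (e.indexEquiv q).1 (e.indexEquiv q).2 := e.ξ q.1 q.2

/-- Allowing any `z'` with the prescribed underlying element makes the lemma usable both when `z'`
is computed from `z` and when `z` is recovered from `z'`. -/
theorem repEquiv_ρ (e : D.Iso D') (q : Σ C, D.I C) (z : D.Z q.1)
    (z' : D'.Z (e.indexEquiv q).1) (hz : (z' : G') = e.φ ((e.h q.1)⁻¹ * z * e.h q.1))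
    (x : D.X q.1 q.2) : e.repEquiv q (D.ρ q.1 q.2 (op z) x) =
      D'.ρ (e.indexEquiv q).1 (e.indexEquiv q).2 (op z') (e.repEquiv q x) := by
  have : z' = D.centralizerMap D' e.φ q.1 (e.h q.1) (e.map_u q.1) z := Subtype.ext hz
  rw [this]
  exact e.map_ρ q.1 q.2 z x

/-- The map of induced modules given by an isomorphism of RSR's. -/
def inducedMap (e : D.Iso D') : D'.inducedDual →ₗ[k] D.inducedDual where
  -- The translation by `h_C⁻¹` matches degrees: conjugating `u'(φ(C))` by `φ(h_C⁻¹ g)` gives `φ(g⁻¹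
  -- u(C) g)`.
  toFun f := ⟨fun q g => f.1 (e.indexEquiv q) (e.φ ((e.h q.1)⁻¹ * g)) ∘ₗ
      (e.repEquiv q).toLinearMap, by
    intro q z g x
    have h : e.φ ((e.h q.1)⁻¹ * (z * g)) =
        (D.centralizerMap D' e.φ q.1 (e.h q.1) (e.map_u q.1) z : G') *
          e.φ ((e.h q.1)⁻¹ * g) := by
      change _ = e.φ ((e.h q.1)⁻¹ * z * e.h q.1) * _
      rw [← map_mul]
      congr 1
      group
    simp only [LinearMap.comp_apply, LinearEquiv.coe_coe]
    rw [h, e.repEquiv_ρ q z (D.centralizerMap D' e.φ q.1 (e.h q.1) (e.map_u q.1) z) rfl]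
    exact f.2 (e.indexEquiv q) _ _ _⟩
  map_add' _ _ := rfl
  map_smul' _ _ := rfl

theorem inducedMap_apply (e : D.Iso D') (f : D'.inducedDual) (q : Σ C, D.I C) (g : G)
    (x : D.X q.1 q.2) : (e.inducedMap f).1 q g x =
      f.1 (e.indexEquiv q) (e.φ ((e.h q.1)⁻¹ * g)) (e.repEquiv q x) := rfl

theorem inducedMap_injective (e : D.Iso D') : Function.Injective e.inducedMap := by
  intro f f' h
  refine Subtype.ext (funext fun q' => funext fun g' => LinearMap.ext fun x' => ?_)
  obtain ⟨q, rfl⟩ := e.indexEquiv.surjective q'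
  obtain ⟨x, rfl⟩ := (e.repEquiv q).surjective x'
  -- The argument is the solution `g` of `φ(h_C⁻¹ g) = g'`.
  have := congrArg (fun f : D.inducedDual => f.1 q (e.h q.1 * e.φ.symm g') x) h
  simpa only [inducedMap_apply, inv_mul_cancel_left, MulEquiv.apply_symm_apply] using this

theorem inducedMap_surjective (e : D.Iso D') : Function.Surjective e.inducedMap := by
  intro f
  -- The target spaces depend on the index, so the inverse substitution is transported along
  -- `indexEquiv`; `hf'` is its computation rule on indices in the image.
  let f' := Equiv.piCongrLeft (fun q' : Σ C', D'.I C' => G' → Module.Dual k (D'.X q'.1 q'.2))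
    e.indexEquiv fun q g' => f.1 q (e.h q.1 * e.φ.symm g') ∘ₗ (e.repEquiv q).symm.toLinearMap
  have hf' : ∀ q g' x', f' (e.indexEquiv q) g' x' =
      f.1 q (e.h q.1 * e.φ.symm g') ((e.repEquiv q).symm x') := fun q g' x' => by
    simp only [f', Equiv.piCongrLeft_apply_apply]
    rfl
  refine ⟨⟨f', fun q' z' g' x' => ?_⟩,
    Subtype.ext (funext fun q => funext fun g => LinearMap.ext fun x => ?_)⟩
  · obtain ⟨q, rfl⟩ := e.indexEquiv.surjective q'
    obtain ⟨x, rfl⟩ := (e.repEquiv q).surjective x'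
    -- This is the preimage of `z'` under `φ_{h_C}`, so that equivariance of `f` applies.
    have hz : e.h q.1 * e.φ.symm z' * (e.h q.1)⁻¹ ∈ D.Z q.1 := by
      rw [mem_Z]
      apply e.φ.injective
      have h1 : (z' : G') * D'.u (ConjClasses.map e.φ.toMonoidHom q.1) =
          D'.u (ConjClasses.map e.φ.toMonoidHom q.1) * z' := mem_Z.1 z'.2
      rw [← e.map_u q.1] at h1
      simp only [map_mul, map_inv, MulEquiv.apply_symm_apply] at h1 ⊢
      calc _ = e.φ (e.h q.1) * (z' * ((e.φ (e.h q.1))⁻¹ * e.φ (D.u q.1) * e.φ (e.h q.1))) *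
            (e.φ (e.h q.1))⁻¹ := by group
        _ = _ := by rw [h1]; group
    have h3 := e.repEquiv_ρ q ⟨_, hz⟩ z' (by
      rw [← MulEquiv.symm_apply_eq]
      group) x
    rw [hf', hf', ← h3, LinearEquiv.symm_apply_apply, LinearEquiv.symm_apply_apply, ← f.2]
    congr 1
    rw [map_mul]
    group
  · rw [inducedMap_apply]
    change f' _ _ _ = _
    rw [hf']
    simp

/-- The isomorphism of induced modules given by an isomorphism of RSR's. -/
def inducedEquiv (e : D.Iso D') : D'.inducedDual ≃ₗ[k] D.inducedDual :=
  LinearEquiv.ofBijective e.inducedMap ⟨e.inducedMap_injective, e.inducedMap_surjective⟩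

theorem inducedEquiv_apply (e : D.Iso D') (f : D'.inducedDual) (q : Σ C, D.I C) (g : G)
    (x : D.X q.1 q.2) : (e.inducedEquiv f).1 q g x =
      f.1 (e.indexEquiv q) (e.φ ((e.h q.1)⁻¹ * g)) (e.repEquiv q x) := rfl

variable [Fintype G] [Fintype G']

/-- The isomorphism of coadjoint Yetter–Drinfeld modules given by an isomorphism of RSR's. -/
def pullPushIso (e : D.Iso D') (F : D.Frame) (F' : D'.Frame) :
    YetterDrinfeld.PullPushIso F'.coad F.coad (DualGroupAlg.congr e.φ.symm) where
  -- Functions pull back along `φ`, so the map goes from the module of `D'` to that of `D`, over the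
  -- Hopf isomorphism given by `φ⁻¹`.
  ψ := (F'.inducedEquiv.trans e.inducedEquiv).trans F.inducedEquiv.symm
  map_act f v := by
    apply F.inducedEquiv.injective
    simp only [LinearEquiv.trans_apply, LinearEquiv.apply_symm_apply]
    refine Subtype.ext (funext fun q => funext fun g => LinearMap.ext fun x => ?_)
    rw [inducedEquiv_apply, F.inducedEquiv_apply, F.toInducedFun_act, F'.inducedEquiv_apply,
      F'.toInducedFun_act, ← F.inducedEquiv_apply, LinearEquiv.apply_symm_apply,
      LinearMap.smul_apply, LinearMap.smul_apply, inducedEquiv_apply, F'.inducedEquiv_apply]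
    congr 1
    rw [DualGroupAlg.congr_apply, MulEquiv.symm_symm]
    congr 1
    rw [indexEquiv_apply, ← e.map_u]
    simp only [← map_inv, ← map_mul]
    congr 1
    group
  map_coact v := by
    refine ext_evalL fun g => ?_
    rw [evalL_map (g := e.φ g) _ _ (fun f => rfl), Frame.evalL_coad_coact, Frame.evalL_coad_coact]
    apply F.inducedEquiv.injective
    simp only [LinearEquiv.trans_apply, LinearEquiv.apply_symm_apply, LinearEquiv.coe_coe]
    refine Subtype.ext (funext fun q => funext fun h => LinearMap.ext fun x => ?_)
    rw [inducedEquiv_apply, F.inducedEquiv_apply, F.toInducedFun_coadOp1, F'.inducedEquiv_apply,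
      F'.toInducedFun_coadOp1, ← F.inducedEquiv_apply, LinearEquiv.apply_symm_apply,
      inducedEquiv_apply, F'.inducedEquiv_apply, ← mul_assoc, map_mul _ _ g⁻¹, map_inv _ g]

end Iso

end RSR

/-! ### Uniqueness of the decomposition of a module into duals of irreducible modules -/

section DualDecomposition

variable {k Γ ι ι' : Type*} [Field k] [Monoid Γ]
variable {X : ι → Type*} [∀ i, AddCommGroup (X i)] [∀ i, Module k (X i)]
variable {X' : ι' → Type*} [∀ i, AddCommGroup (X' i)] [∀ i, Module k (X' i)]

open Classical in
-- The block of `L` from the dual of `X i` to the dual of `X' i'` is the transpose of an intertwiner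
-- `X' i' → X i`. A nonzero block gives a nonzero intertwiner of irreducibles, which is bijective by
-- Schur's lemma.
theorem exists_linearEquiv_of_dual_block_ne_zero [∀ i, FiniteDimensional k (X i)]
    (ρ : ∀ i, Representation k Γ (X i)) (ρ' : ∀ i, Representation k Γ (X' i))
    (hρ : ∀ i, (ρ i).IsIrreducible) (hρ' : ∀ i, (ρ' i).IsIrreducible)
    (L : (∀ i, Module.Dual k (X i)) →ₗ[k] ∀ i, Module.Dual k (X' i))
    (hL : ∀ m γ i' x, L (fun i => m i ∘ₗ ρ i γ) i' x = L m i' (ρ' i' γ x))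
    {i : ι} {i' : ι'} {m : Module.Dual k (X i)} (h : L (Pi.single i m) i' ≠ 0) :
    ∃ ξ : X' i' ≃ₗ[k] X i, ∀ γ x, ξ (ρ' i' γ x) = ρ i γ (ξ x) := by
  let lam : X' i' →ₗ[k] X i := (Module.evalEquiv k (X i)).symm.toLinearMap ∘ₗ
    (LinearMap.proj i' ∘ₗ L ∘ₗ LinearMap.single k (fun i => Module.Dual k (X i)) i).flip
  have hlam : ∀ m x, m (lam x) = L (Pi.single i m) i' x := fun m x => by
    simp only [lam, LinearMap.comp_apply, LinearEquiv.coe_coe, Module.apply_evalEquiv_symm_apply]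
    rfl
  -- Vectors of `X i` are separated by functionals, and against a functional `m` the claim is `hL`
  -- for the family supported at `i`.
  have hequiv : ∀ γ x, lam (ρ' i' γ x) = ρ i γ (lam x) := by
    intro γ x
    rw [← sub_eq_zero, ← Module.forall_dual_apply_eq_zero_iff k]
    intro m
    rw [map_sub, sub_eq_zero, hlam, ← hL]
    refine Eq.trans ?_ (hlam (m ∘ₗ ρ i γ) x).symm
    refine congrArg (fun m => L m i' x) (funext fun j => ?_)
    rcases eq_or_ne j i with rfl | hj
    · rw [Pi.single_eq_same, Pi.single_eq_same]
    · rw [Pi.single_eq_of_ne hj, Pi.single_eq_of_ne hj, LinearMap.zero_comp]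
  have := hρ i
  have := hρ' i'
  let f := lam.intertwiningMap_of_isIntertwiningMap (ρ' i') (ρ i) hequiv
  rcases Representation.IsIrreducible.bijective_or_eq_zero f with hf | hf
  · exact ⟨LinearEquiv.ofBijective lam hf, hequiv⟩
  · refine absurd (LinearMap.ext fun x => ?_) h
    have h0 : lam x = 0 := congrArg (fun f : Representation.IntertwiningMap (ρ' i') (ρ i) => f x) hf
    rw [← hlam, h0, map_zero, LinearMap.zero_apply]

open Classical in
-- If no block of `L` joins different labels, `L` maps the factors labelled `s` into the factors
-- labelled `s`, still injectively; dimensions are then compared.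
theorem sum_finrank_fiber_le [Fintype ι] [Fintype ι'] {W : ι → Type*} {W' : ι' → Type*}
    [∀ i, AddCommGroup (W i)] [∀ i, Module k (W i)] [∀ i, AddCommGroup (W' i)]
    [∀ i, Module k (W' i)] [∀ i, FiniteDimensional k (W i)] [∀ i, FiniteDimensional k (W' i)]
    (L : (∀ i, W i) →ₗ[k] ∀ i, W' i) (hL : Function.Injective L) {K : Type*} [DecidableEq K] (c : ι → K)
    (c' : ι' → K) (hc : ∀ i i' m, L (Pi.single i m) i' ≠ 0 → c i = c' i') (s : K) :
    ∑ i : {i // c i = s}, Module.finrank k (W i) ≤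
      ∑ i : {i // c' i = s}, Module.finrank k (W' i) := by
  let E : (∀ i : {i // c i = s}, W i) →ₗ[k] ∀ i, W i :=
    LinearMap.pi fun i => if h : c i = s then
      LinearMap.proj (φ := fun i : {i // c i = s} => W i) ⟨i, h⟩ else 0
  let R : (∀ i, W' i) →ₗ[k] ∀ i : {i // c' i = s}, W' i := LinearMap.pi fun i => LinearMap.proj i.1
  have hE : ∀ m (i : {i // c i = s}), E m i = m i := fun m i => by
    simp only [E, LinearMap.pi_apply, dif_pos i.2]
    rfl
  have hE' : ∀ m i, c i ≠ s → E m i = 0 := fun m i hi => by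
    simp only [E, LinearMap.pi_apply, dif_neg hi]
    rfl
  have hinj : Function.Injective (R ∘ₗ L ∘ₗ E) := by
    rw [← LinearMap.ker_eq_bot, LinearMap.ker_eq_bot']
    intro m hm
    -- Components with label `s` vanish by `hm`, the others because every block reaching them from
    -- label `s` is zero.
    have h0 : L (E m) = 0 := by
      funext i'
      by_cases hi' : c' i' = s
      · exact congrFun hm ⟨i', hi'⟩
      · rw [← Finset.univ_sum_single (E m), map_sum, Finset.sum_apply]
        refine Finset.sum_eq_zero fun i _ => ?_
        by_contra h
        refine h ?_
        rw [hE' m i fun hi => hi' ((hc i i' _ h).symm.trans hi), Pi.single_zero, map_zero]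
        rfl
    have h1 : E m = 0 := hL (h0.trans (map_zero L).symm)
    funext i
    exact (hE m i).symm.trans (congrFun h1 i)
  have := LinearMap.finrank_le_finrank_of_injective hinj
  rwa [Module.finrank_pi_fintype, Module.finrank_pi_fintype] at this

/-- For each isomorphism type the factors of that type have the same total dimension on both sides,
by `sum_finrank_fiber_le` for `L` and its inverse. All of them have equal positive dimension, so
their numbers agree, and bijections of the fibres assemble to `e`. -/
theorem exists_equiv_of_dual_equiv [Finite ι] [Finite ι'] [∀ i, FiniteDimensional k (X i)]
    [∀ i, FiniteDimensional k (X' i)]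
    (ρ : ∀ i, Representation k Γ (X i)) (ρ' : ∀ i, Representation k Γ (X' i))
    (hρ : ∀ i, (ρ i).IsIrreducible) (hρ' : ∀ i, (ρ' i).IsIrreducible)
    (hX : ∀ i, Nontrivial (X i)) (hX' : ∀ i, Nontrivial (X' i))
    (L : (∀ i, Module.Dual k (X i)) ≃ₗ[k] ∀ i, Module.Dual k (X' i))
    (hL : ∀ m γ i' x, L (fun i => m i ∘ₗ ρ i γ) i' x = L m i' (ρ' i' γ x)) :
    ∃ e : ι ≃ ι', ∀ i, ∃ ξ : X i ≃ₗ[k] X' (e i), ∀ γ x, ξ (ρ i γ x) = ρ' (e i) γ (ξ x) := by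
  classical
  have := Fintype.ofFinite ι
  have := Fintype.ofFinite ι'
  -- The label of a representation is the set of `j` for which `X j` is isomorphic to it. Using
  -- indices from `ι` on both sides gives the two families a common type of labels.
  let c : ι → ι → Prop := fun i j => ∃ ξ : X j ≃ₗ[k] X i, ∀ γ x, ξ (ρ j γ x) = ρ i γ (ξ x)
  let c' : ι' → ι → Prop := fun i' j =>
    ∃ ξ : X j ≃ₗ[k] X' i', ∀ γ x, ξ (ρ j γ x) = ρ' i' γ (ξ x)
  have hc : ∀ i i', (∃ ξ : X' i' ≃ₗ[k] X i, ∀ γ x, ξ (ρ' i' γ x) = ρ i γ (ξ x)) → c i = c' i' := by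
    rintro i i' ⟨ξ, hξ⟩
    have hξ' : ∀ γ x, ξ.symm (ρ i γ x) = ρ' i' γ (ξ.symm x) := fun γ x => by
      rw [LinearEquiv.symm_apply_eq, hξ, LinearEquiv.apply_symm_apply]
    refine funext fun j => propext ⟨?_, ?_⟩
    · rintro ⟨η, hη⟩
      exact ⟨η.trans ξ.symm, fun γ x => by simp only [LinearEquiv.trans_apply, hη, hξ']⟩
    · rintro ⟨η, hη⟩
      exact ⟨η.trans ξ, fun γ x => by simp only [LinearEquiv.trans_apply, hη, hξ]⟩
  have hL' : ∀ m γ i x, L.symm (fun i' => m i' ∘ₗ ρ' i' γ) i x = L.symm m i (ρ i γ x) := by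
    intro m γ i x
    have : L.symm (fun i' => m i' ∘ₗ ρ' i' γ) = fun i => L.symm m i ∘ₗ ρ i γ := by
      rw [LinearEquiv.symm_apply_eq]
      funext i'
      refine LinearMap.ext fun x => ?_
      rw [hL, LinearEquiv.apply_symm_apply]
      rfl
    rw [this]
    rfl
  have hsum : ∀ s, ∑ i : {i // c i = s}, Module.finrank k (X i) =
      ∑ i : {i // c' i = s}, Module.finrank k (X' i) := by
    intro s
    have h1 := sum_finrank_fiber_le L.toLinearMap L.injective c c' (fun i i' m h =>
      hc i i' (exists_linearEquiv_of_dual_block_ne_zero ρ ρ' hρ hρ' L.toLinearMap hL h)) s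
    have h2 := sum_finrank_fiber_le L.symm.toLinearMap L.symm.injective c' c (fun i' i m h => by
      obtain ⟨ξ, hξ⟩ :=
        exists_linearEquiv_of_dual_block_ne_zero ρ' ρ hρ' hρ L.symm.toLinearMap hL' h
      refine (hc i i' ⟨ξ.symm, fun γ x => ?_⟩).symm
      rw [LinearEquiv.symm_apply_eq, hξ, LinearEquiv.apply_symm_apply]) s
    simp only [Subspace.dual_finrank_eq] at h1 h2
    exact le_antisymm h1 h2
  have hdim : ∀ s (j : ι), s j → (∀ i : {i // c i = s}, Module.finrank k (X i) =
      Module.finrank k (X j)) ∧ ∀ i : {i // c' i = s}, Module.finrank k (X' i) =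
      Module.finrank k (X j) := by
    refine fun s j hj => ⟨fun ⟨i, hi⟩ => ?_, fun ⟨i, hi⟩ => ?_⟩
    · rw [← hi] at hj
      obtain ⟨ξ, -⟩ := hj
      exact ξ.finrank_eq.symm
    · rw [← hi] at hj
      obtain ⟨ξ, -⟩ := hj
      exact ξ.finrank_eq.symm
  have hpos : ∀ j, 0 < Module.finrank k (X j) := fun j => Module.finrank_pos
  have hpos' : ∀ j, 0 < Module.finrank k (X' j) := fun j => Module.finrank_pos
  have hself : ∀ i, c i i := fun i => ⟨LinearEquiv.refl k _, fun _ _ => rfl⟩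
  have hcard : ∀ s, Fintype.card {i // c i = s} = Fintype.card {i // c' i = s} := by
    intro s
    have h := hsum s
    by_cases hs : ∃ j, s j
    · obtain ⟨j, hj⟩ := hs
      obtain ⟨h1, h2⟩ := hdim s j hj
      simp only [h1, h2, Finset.sum_const, Finset.card_univ, smul_eq_mul] at h
      exact Nat.eq_of_mul_eq_mul_right (hpos j) h
    -- An empty label is never attained by an `X i`; the sum over the other fibre is then zero, and
    -- positive dimensions make that fibre empty.
    · have : IsEmpty {i // c i = s} := ⟨fun ⟨i, hi⟩ => hs ⟨i, hi ▸ hself i⟩⟩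
      rw [Finset.univ_eq_empty, Finset.sum_empty, eq_comm, Finset.sum_eq_zero_iff] at h
      have : IsEmpty {i // c' i = s} := ⟨fun i => (hpos' i.1).ne' (h i (Finset.mem_univ i))⟩
      rw [Fintype.card_eq_zero, Fintype.card_eq_zero]
  let e : ι ≃ ι' := Equiv.ofFiberEquiv (f := c) (g := c') fun s => Fintype.equivOfCardEq (hcard s)
  have he : ∀ i, c' (e i) = c i := Equiv.ofFiberEquiv_map _
  -- Equality of the labels of `e i` and `i`, read at the index `i`, is the required isomorphism.
  exact ⟨e, fun i => (congrFun (he i) i).mpr (hself i)⟩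

end DualDecomposition

/-! ### From isomorphisms of Yetter–Drinfeld modules to isomorphisms of RSR's -/

namespace RSR

open MulOpposite DualGroupAlg

variable {k : Type uk} {G : Type uG} [Field k] [Group G]

namespace Frame

variable {D : RSR k G} (F : D.Frame)

/-- The pairs `(i, j)` index the arrows from `1` to `u(C)`. -/
theorem finite_sigma (D : RSR k G) [hQ : Finite D.Arrow] (C : ConjClasses G) :
    Finite (Σ i, D.J C i) := by
  refine Finite.of_injective
    (fun q => (⟨1, D.u C, C, mk_one_inv_mul_u D C, q.1, q.2⟩ : D.Arrow)) ?_
  rintro ⟨i, j⟩ ⟨i', j'⟩ h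
  simpa using h

theorem finite_I (D : RSR k G) [Finite D.Arrow] (C : ConjClasses G) : Finite (D.I C) :=
  have := finite_sigma D C
  Finite.of_surjective (fun q : Σ i, D.J C i => q.1) fun i =>
    ⟨⟨i, (D.nonempty_J C i).some⟩, rfl⟩

include F in
theorem finiteDimensional_X [Finite D.Arrow] (C : ConjClasses G) (i : D.I C) :
    FiniteDimensional k (D.X C i) := by
  have := finite_sigma D C
  have : Finite (D.J C i) := Finite.of_injective (fun j => (⟨i, j⟩ : Σ i, D.J C i)) fun j j' h => by
    simpa using h
  exact Module.Finite.of_basis (F.basis C i)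

include F in
theorem nontrivial_X (C : ConjClasses G) (i : D.I C) : Nontrivial (D.X C i) :=
  ⟨F.basis C i (D.nonempty_J C i).some, 0, (F.basis C i).ne_zero _⟩

/-! ### Homogeneous components of the coadjoint module. -/

variable [Fintype G]

/-- The element of `kQ_1^{1a}` of degree `u(C)` with given pairings. -/
def degreeSection (C : ConjClasses G) (m : ∀ i, Module.Dual k (D.X C i)) : D.Arrow1 → k := by
  classical
  -- Extending `m` by zero to all classes through `Pi.single` allows evaluation at the class of `a`
  -- without a cast; the condition on the target forces that class to be `C`.
  exact fun a => if a.1.tgt = D.u C then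
    Pi.single (M := fun C => ∀ i, Module.Dual k (D.X C i)) C m a.1.cls a.1.i
      (F.basis a.1.cls a.1.i a.1.j) else 0

/-- The pairings of an element of `kQ_1^{1a}` with the arrows from `1` to `u(C)`. -/
def degreePairing (C : ConjClasses G) :
    (D.Arrow1 → k) →ₗ[k] ∀ i, Module.Dual k (D.X C i) where
  toFun v i := F.pairing v (D.u C) C (mk_one_inv_mul_u D C) i
  map_add' v w := by
    refine funext fun i => LinearMap.ext fun x => ?_
    simp [pairing, Finsupp.linearCombination_apply, Finsupp.sum, mul_add,
      Finset.sum_add_distrib]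
  map_smul' c v := by
    refine funext fun i => LinearMap.ext fun x => ?_
    simp [pairing, Finsupp.linearCombination_apply, Finsupp.sum, mul_left_comm,
      Finset.mul_sum]

theorem degreePairing_apply (C : ConjClasses G) (v : D.Arrow1 → k) (i : D.I C) :
    F.degreePairing C v i = F.pairing v (D.u C) C (mk_one_inv_mul_u D C) i := rfl

theorem degreePairing_degreeSection (C : ConjClasses G) (m : ∀ i, Module.Dual k (D.X C i)) :
    F.degreePairing C (F.degreeSection C m) = m := by
  funext i
  refine (F.basis C i).ext fun j => ?_
  rw [degreePairing_apply, F.pairing_basis _ ⟨⟨1, D.u C, C, mk_one_inv_mul_u D C, i, j⟩, rfl⟩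
    (D.u C) C _ i j rfl]
  simp [degreeSection]

/-- The elements of `kQ_1^{1a}` of degree `d`. -/
def degree (D : RSR k G) (d : G) : Submodule k (D.Arrow1 → k) where
  carrier := {v | ∀ a, a.1.tgt ≠ d → v a = 0}
  add_mem' hv hw a ha := by simp [hv a ha, hw a ha]
  zero_mem' _ _ := rfl
  smul_mem' c v hv a ha := by simp [hv a ha]

/-- The degree is thereby expressed through the action alone, hence in terms that isomorphisms
preserve; the converse direction tests with `p_d`. -/
theorem mem_degree_iff_act (v : D.Arrow1 → k) (d : G) :
    v ∈ degree D d ↔ ∀ f : DualGroupAlg k G, F.coad.act f v = f d • v := by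
  constructor
  · intro hv f
    funext a
    rw [coad_act_apply, Pi.smul_apply, smul_eq_mul]
    by_cases ha : a.1.tgt = d
    · rw [ha]
    · rw [hv a ha, mul_zero, mul_zero]
  · intro h a ha
    have := congrFun (h (p d)) a
    rw [coad_act_apply, Pi.smul_apply, smul_eq_mul] at this
    simpa [ha] using this.symm

theorem degreeSection_mem (C : ConjClasses G) (m : ∀ i, Module.Dual k (D.X C i)) :
    F.degreeSection C m ∈ degree D (D.u C) := fun _ ha => if_neg ha

theorem eq_zero_of_degreePairing_eq_zero (C : ConjClasses G) (v : D.Arrow1 → k)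
    (hv : v ∈ degree D (D.u C)) (h : F.degreePairing C v = 0) : v = 0 := by
  funext a
  by_cases ha : a.1.tgt = D.u C
  · obtain ⟨⟨s, d, C', hC, i, j⟩, hs⟩ := a
    obtain rfl : s = 1 := hs
    obtain rfl : d = D.u C := ha
    obtain rfl : C' = C := hC.symm.trans (mk_one_inv_mul_u D C)
    rw [← F.pairing_basis v _ (D.u C') C' hC i j rfl]
    exact LinearMap.congr_fun (congrFun h i) _
  · exact hv a ha

/-- The space of elements of degree `u(C)` is the product of the dual spaces of the
representations. -/
def degreeEquiv (C : ConjClasses G) : degree D (D.u C) ≃ₗ[k] ∀ i, Module.Dual k (D.X C i) :=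
  LinearEquiv.ofBijective (F.degreePairing C ∘ₗ (degree D (D.u C)).subtype)
    ⟨by
      rw [← LinearMap.ker_eq_bot, LinearMap.ker_eq_bot']
      exact fun v hv => Subtype.ext (F.eq_zero_of_degreePairing_eq_zero C v.1 v.2 hv),
    fun m => ⟨⟨F.degreeSection C m, F.degreeSection_mem C m⟩, F.degreePairing_degreeSection C m⟩⟩

theorem degreeEquiv_apply (C : ConjClasses G) (v : degree D (D.u C)) :
    F.degreeEquiv C v = F.degreePairing C v.1 := rfl

/-- This is the Yetter–Drinfeld compatibility in graded form: the operator of `g` conjugates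
degrees. -/
theorem coadOp1_act (g : G) {f f' : DualGroupAlg k G} (hf : ∀ x, f' x = f (g * x * g⁻¹))
    (v : D.Arrow1 → k) : F.coadOp1 g (F.coad.act f v) = F.coad.act f' (F.coadOp1 g v) := by
  refine F.ext_pairing fun d C hC i x => ?_
  have hC' : ConjClasses.mk ((1 : G)⁻¹ * (g⁻¹⁻¹ * d * g⁻¹)) = C := by
    rw [inv_one, one_mul, mk_conj, ← hC, inv_one, one_mul]
  rw [pairing_act, ← inv_inv g, LinearMap.smul_apply, F.pairing_coadOp1 _ g⁻¹ d C hC hC',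
    F.pairing_coadOp1 _ g⁻¹ d C hC hC', pairing_act, LinearMap.smul_apply]
  simp [hf]

theorem coadOp1_mem_degree (g d : G) {v : D.Arrow1 → k} (hv : v ∈ degree D d) :
    F.coadOp1 g v ∈ degree D (g⁻¹ * d * g) := by
  rw [F.mem_degree_iff_act] at hv ⊢
  intro f
  let f' : DualGroupAlg k G := fun x => f (g⁻¹ * x * g)
  have h := F.coadOp1_act g (f := f') (f' := f) (fun x => congrArg f (by group)) v
  rw [hv, map_smul] at h
  exact h.symm

theorem coadOp1_inv_apply (g : G) (v : D.Arrow1 → k) : F.coadOp1 g⁻¹ (F.coadOp1 g v) = v := by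
  rw [← coadOp1_mul, mul_inv_cancel, coadOp1_one, LinearMap.id_apply]

end Frame

/-! ### Reconstruction of the RSR from the Yetter–Drinfeld module. -/

section Reconstruction

variable {G' : Type*} [Group G'] [Fintype G] [Fintype G'] {D : RSR k G} {D' : RSR k G'}
  {F : D.Frame} {F' : D'.Frame} {φ : DualGroupAlg k G ≃ₐc[k] DualGroupAlg k G'}

open YetterDrinfeld QuiverHopf.RSR.Frame

/-- Evaluating compatibility with the coactions at `α g` extracts the operators of `g` and `α g`. -/
theorem pullPushIso_coadOp1 (e : PullPushIso F.coad F'.coad φ) {α : G ≃* G'}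
    (hα : ∀ f g', φ f g' = f (α.symm g')) (g : G) (v : D.Arrow1 → k) :
    e.ψ (F.coadOp1 g v) = F'.coadOp1 (α g) (e.ψ v) := by
  have h := congrArg (evalL (α g)) (e.map_coact v)
  rw [evalL_map (g := g) (φ : DualGroupAlg k G →ₗ[k] DualGroupAlg k G') _
    (fun f => (hα f (α g)).trans (by rw [MulEquiv.symm_apply_apply])),
    evalL_coad_coact, evalL_coad_coact] at h
  exact h

theorem pullPushIso_mem_degree (e : PullPushIso F.coad F'.coad φ) {α : G ≃* G'}
    (hα : ∀ f g', φ f g' = f (α.symm g')) (d : G) (v : D.Arrow1 → k) :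
    e.ψ v ∈ degree D' (α d) ↔ v ∈ degree D d := by
  have h : ∀ f, φ f (α d) = f d := fun f =>
    (hα f (α d)).trans (by rw [MulEquiv.symm_apply_apply])
  rw [F.mem_degree_iff_act, F'.mem_degree_iff_act]
  constructor
  · intro hv f
    apply e.ψ.injective
    rw [e.map_act, hv, h, map_smul]
  · intro hv f'
    obtain ⟨f, rfl⟩ : ∃ f, φ f = f' := φ.surjective f'
    rw [← e.map_act, hv, h, map_smul]

/-- The comparison of the homogeneous components whose degrees are the chosen elements of
corresponding conjugacy classes. -/
def degreeComparison (e : PullPushIso F.coad F'.coad φ) {α : G ≃* G'}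
    (hα : ∀ f g', φ f g' = f (α.symm g')) {d h : G} {d' : G'} (hd : α (h⁻¹ * d * h) = d') :
    degree D d ≃ₗ[k] degree D' d' :=
  LinearEquiv.ofBijective
    -- The operator of `h` moves degree `d` to `h⁻¹ d h`, which `ψ` sends to degree `d'`.
    ((e.ψ.toLinearMap ∘ₗ F.coadOp1 h).restrict (p := degree D d) (q := degree D' d') (by
      intro v hv
      rw [← hd]
      exact (pullPushIso_mem_degree e hα _ _).2 (F.coadOp1_mem_degree h d hv)))
    ⟨fun v w hvw => by
      have h1 : F.coadOp1 h v.1 = F.coadOp1 h w.1 := e.ψ.injective (congrArg Subtype.val hvw)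
      have h2 := congrArg (F.coadOp1 h⁻¹) h1
      rw [coadOp1_inv_apply, coadOp1_inv_apply] at h2
      exact Subtype.ext h2,
    fun w => by
      obtain ⟨v, hv⟩ := e.ψ.surjective w.1
      have hw : v ∈ degree D (h⁻¹ * d * h) := by
        rw [← pullPushIso_mem_degree e hα, hd, hv]
        exact w.2
      have h1 := F.coadOp1_mem_degree h⁻¹ _ hw
      have h2 : h⁻¹⁻¹ * (h⁻¹ * d * h) * h⁻¹ = d := by group
      rw [h2] at h1
      refine ⟨⟨_, h1⟩, Subtype.ext ?_⟩
      change e.ψ (F.coadOp1 h (F.coadOp1 h⁻¹ v)) = w.1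
      rw [← hv]
      have h3 := F.coadOp1_inv_apply h⁻¹ v
      rw [inv_inv] at h3
      rw [h3]⟩

theorem degreeComparison_apply (e : PullPushIso F.coad F'.coad φ) {α : G ≃* G'}
    (hα : ∀ f g', φ f g' = f (α.symm g')) {d h : G} {d' : G'} (hd : α (h⁻¹ * d * h) = d')
    (v : degree D d) : (degreeComparison e hα hd v).1 = e.ψ (F.coadOp1 h v.1) := rfl

/-- Along a surjection the invariant subspaces do not change. -/
theorem isIrreducible_comp_of_surjective {Γ Δ W : Type*} [Monoid Γ] [Monoid Δ] [AddCommGroup W]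
    [Module k W] (ρ : Representation k Δ W) (hρ : ρ.IsIrreducible) (σ : Γ →* Δ)
    (hσ : Function.Surjective σ) :
    Representation.IsIrreducible (ρ.comp σ : Representation k Γ W) := by
  let E : Subrepresentation (ρ.comp σ : Representation k Γ W) ≃o Subrepresentation ρ :=
    { toFun := fun U => ⟨U.toSubmodule, fun δ v hv => by
        obtain ⟨γ, rfl⟩ := hσ δ
        exact U.apply_mem_toSubmodule γ hv⟩
      invFun := fun U => ⟨U.toSubmodule, fun γ v hv => U.apply_mem_toSubmodule (σ γ) hv⟩
      left_inv := fun _ => rfl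
      right_inv := fun _ => rfl
      map_rel_iff' := Iff.rfl }
  exact E.isSimpleOrder_iff.2 hρ

theorem centralizerMap_surjective (D : RSR k G) (D' : RSR k G') (φ : G ≃* G') (C : ConjClasses G)
    (h : G) (hh : φ (h⁻¹ * D.u C * h) = D'.u (ConjClasses.map φ.toMonoidHom C)) :
    Function.Surjective (D.centralizerMap D' φ C h hh) := by
  intro z'
  have hz : h * φ.symm z' * h⁻¹ ∈ D.Z C := by
    rw [mem_Z]
    apply φ.injective
    have h1 := mem_Z.1 z'.2
    rw [← hh] at h1
    simp only [map_mul, map_inv, MulEquiv.apply_symm_apply] at h1 ⊢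
    calc _ = φ h * (z' * ((φ h)⁻¹ * φ (D.u C) * φ h)) * (φ h)⁻¹ := by group
      _ = _ := by rw [h1]; group
  refine ⟨⟨_, hz⟩, Subtype.ext ?_⟩
  change φ (h⁻¹ * (h * φ.symm z' * h⁻¹) * h) = z'
  rw [← MulEquiv.eq_symm_apply]
  group

/-- The components of degrees `u(C)` and `u'(α(C))` are products of duals of irreducibles, those of
`D'` being regarded as representations of `Z_{u(C)}` through `centralizerMap`. Their comparison is
equivariant, so `exists_equiv_of_dual_equiv` applies. -/
theorem exists_representation_equiv [Finite D.Arrow] [Finite D'.Arrow]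
    (e : PullPushIso F.coad F'.coad φ) {α : G ≃* G'}
    (hα : ∀ f g', φ f g' = f (α.symm g')) (C : ConjClasses G) (h : G)
    (hh : α (h⁻¹ * D.u C * h) = D'.u (ConjClasses.map α.toMonoidHom C)) :
    ∃ ε : D.I C ≃ D'.I (ConjClasses.map α.toMonoidHom C), ∀ i,
      ∃ ξ : D.X C i ≃ₗ[k] D'.X (ConjClasses.map α.toMonoidHom C) (ε i), ∀ (z : D.Z C) x,
        ξ (D.ρ C i (op z) x) = D'.ρ _ (ε i) (op (D.centralizerMap D' α C h hh z)) (ξ x) := by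
  have := finite_I D C
  have := finite_I D' (ConjClasses.map α.toMonoidHom C)
  have := F.finiteDimensional_X C
  have := F'.finiteDimensional_X (ConjClasses.map α.toMonoidHom C)
  let σ := MonoidHom.op (D.centralizerMap D' α C h hh)
  have hσ : Function.Surjective σ := fun z' => by
    obtain ⟨z, hz⟩ := centralizerMap_surjective D D' α C h hh (unop z')
    exact ⟨op z, unop_injective hz⟩
  let L := (F.degreeEquiv C).symm.trans ((degreeComparison e hα hh).trans
    (F'.degreeEquiv (ConjClasses.map α.toMonoidHom C)))
  obtain ⟨ε, hε⟩ := exists_equiv_of_dual_equiv (D.ρ C)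
    (fun i' => ((D'.ρ (ConjClasses.map α.toMonoidHom C) i').comp σ :
      Representation k (D.Z C)ᵐᵒᵖ (D'.X _ i')))
    (D.irreducible C)
    (fun i' => isIrreducible_comp_of_surjective _ (D'.irreducible _ i') σ hσ)
    (F.nontrivial_X C) (F'.nontrivial_X _) L (by
      intro m γ i' x
      obtain ⟨v, rfl⟩ := (F.degreeEquiv C).surjective m
      obtain ⟨z, rfl⟩ := op_surjective γ
      have hd : (z : G)⁻¹⁻¹ * D.u C * (z : G)⁻¹ = D.u C := by
        rw [inv_inv, mem_Z.1 z.2, mul_inv_cancel_right]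
      have hw : F.coadOp1 (z : G)⁻¹ v.1 ∈ degree D (D.u C) := by
        have := F.coadOp1_mem_degree (z : G)⁻¹ _ v.2
        rwa [hd] at this
      -- Precomposition with `ρ(z)` is the operator of `z⁻¹` on the component of degree `u(C)`.
      have h1 : (fun i => F.degreeEquiv C v i ∘ₗ D.ρ C i (op z)) =
          F.degreeEquiv C ⟨_, hw⟩ := by
        funext i
        refine LinearMap.ext fun y => ?_
        exact (F.pairing_coadOp1_inv_coe v.1 C i z _ y).symm
      rw [h1]
      simp only [L, LinearEquiv.trans_apply, LinearEquiv.symm_apply_apply]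
      rw [degreeEquiv_apply, degreeEquiv_apply, degreeComparison_apply, degreeComparison_apply,
        degreePairing_apply, degreePairing_apply, ← coadOp1_mul]
      -- Moving `z⁻¹` past `h` turns it into the inverse of `h⁻¹ z h`, whose image under `α` is the
      -- value of `centralizerMap` at `z`.
      have h2 : (z : G)⁻¹ * h = h * (h⁻¹ * z * h)⁻¹ := by group
      rw [h2, coadOp1_mul, pullPushIso_coadOp1 e hα, map_inv]
      exact F'.pairing_coadOp1_inv_coe (e.ψ (F.coadOp1 h v.1)) _ i'
        (D.centralizerMap D' α C h hh z) _ x)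
  exact ⟨ε, fun i => (hε i).imp fun ξ hξ z x => hξ (op z) x⟩

theorem nonempty_iso_of_pullPushIso [Finite D.Arrow] [Finite D'.Arrow]
    (e : PullPushIso F.coad F'.coad φ) : Nonempty (D.Iso D') := by
  obtain ⟨α, hα⟩ := exists_eq_congr φ
  have h1 : ∀ C, ∃ h, α (h⁻¹ * D.u C * h) = D'.u (ConjClasses.map α.toMonoidHom C) := by
    intro C
    have : ConjClasses.mk (α (D.u C)) =
        ConjClasses.mk (D'.u (ConjClasses.map α.toMonoidHom C)) := by
      rw [D'.mk_u]
      conv_rhs => rw [← D.mk_u C]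
      rfl
    obtain ⟨g', hg'⟩ := isConj_iff.1 (ConjClasses.mk_eq_mk_iff_isConj.1 this)
    -- As `g'` conjugates `α(u(C))` to `u'(α(C))`, the equation for `h` asks for `α(h)⁻¹ = g'`.
    refine ⟨(α.symm g')⁻¹, ?_⟩
    rw [← hg']
    simp
  choose h hh using h1
  choose ε ξ hξ using fun C => exists_representation_equiv e hα C (h C) (hh C)
  exact ⟨⟨α, h, hh, ε, ξ, hξ⟩⟩

end Reconstruction

end RSR

end

end QuiverHopf

theorem proposition5p1 {k G G' : Type*} [Field k] [Group G] [Fintype G] [Group G'] [Fintype G']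
    (hG : ¬ ringChar k ∣ Fintype.card G) (hG' : ¬ ringChar k ∣ Fintype.card G')
    (D : QuiverHopf.RSR k G) (D' : QuiverHopf.RSR k G')
    (hQ : Finite D.Arrow) (hQ' : Finite D'.Arrow) (F : D.Frame) (F' : D'.Frame) :
    List.TFAE [
      Nonempty (D.Iso D'),
      ∃ φ : QuiverHopf.DualGroupAlg k G ≃ₐc[k] QuiverHopf.DualGroupAlg k G',
        Nonempty (QuiverHopf.YetterDrinfeld.PullPushIso F.coad F'.coad φ),
      ∃ φ : QuiverHopf.DualGroupAlg k G ≃ₐc[k] QuiverHopf.DualGroupAlg k G',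
        Nonempty (QuiverHopf.YetterDrinfeld.NicholsPullPushIso F.coad F'.coad φ)] := by
  -- The inverse is taken because `Iso.pullPushIso` runs from the module of `D'` to that of `D`.
  tfae_have 1 → 2 := fun ⟨e⟩ => ⟨_, ⟨(e.pullPushIso F F').symm⟩⟩
  tfae_have 2 → 1 := fun ⟨_, ⟨e⟩⟩ => QuiverHopf.RSR.nonempty_iso_of_pullPushIso e
  tfae_have 2 → 3 := fun ⟨φ, ⟨e⟩⟩ => ⟨φ, ⟨e.nichols⟩⟩
  tfae_have 3 → 2 := fun ⟨φ, ⟨e⟩⟩ => ⟨φ, ⟨e.pullPushIso⟩⟩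
  tfae_finish
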